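/- Let $\mathcal A,\mathcal B$ be nonempty separable metric spaces (for example, arbitrary nonempty subsets of Euclidean spaces), let $f:\mathbb R^n\times\mathcal A\times\mathcal B\to\mathbb R^n$ be bounded and Lipschitz continuous, let $K\subseteq\mathbb R^n$ be closed, and let $\bar T\ge 0$. Put $\hat f(s,a,b)=f(s,a,b)$ and $\mathbb I(s)=1$ for $s\notin K$, and $\hat f(s,a,b)=0$ and $\mathbb I(s)=0$ for $s\in K$. For $t\le\bar T$ let $\mathscr A_t,\mathscr B_t$ be the sets of Lebesgue measurable functions from $[t,\infty)$ to $\mathcal A$ and $\mathcal B$, and let $\mathfrak B_t$ be the set of nonanticipative strategies, i.e. of maps $\beta:\mathscr A_t\to\mathscr B_t$ such that, for every $r\ge t$, $a=\hat a$ a.e. on $[t,r]$ implies $\beta[a]=\beta[\hat a]$ a.e. on $[t,r]$. For $a\in\mathscr A_t$, $b\in\mathscr B_t$ let $\hat\phi_{s,t}^{a,b}:[t,\infty)\to\mathbb R^n$ be the (Carathéodory) trajectory of $\dot x=\hat f(x,a,b)$, $x(t)=s$, that stays where it is once it has touched $K$. Define $$W_{\bar T}(s,t)=\sup_{\beta\in\mathfrak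 B_t}\ \inf_{a\in\mathscr A_t}\int_t^{\bar T}\mathbb I\big(\hat\phi_{s,t}^{a,\beta[a]}(u)\big)\,du,\qquad H(s,p)=\min_{a\in\mathcal A}\max_{b\in\mathcal B}\{\mathbb I(s)+p\cdot\hat f(s,a,b)\}$$ (read $\inf$ and $\sup$ for $\min$ and $\max$ where these are not attained; they are attained if $\mathcal A,\mathcal B$ are compact). Then $W_{\bar T}$ is a viscosity solution of $$\partial_t W+H(s,\partial_s W)=0\quad (s\in\mathbb R^n,\ t<\bar T),\qquad W(s,\bar T)=0 .$$ Since $W_{\bar T}$ and $H$ may be discontinuous, this means the following. Write $g^*$ and $g_*$ for the upper and lower semicontinuous envelopes of $g$. The function $W_{\bar T}$ is locally bounded on $\mathbb R^n\times(-\infty,\bar T)$, and for every $C^1$ function $\varphi$ on $\mathbb R^n\times\mathbb R$ and every $(s,t)$ with $t<\bar T$: - if $(W_{\bar T})^*-\varphi$ has a local maximum at $(s,t)$, then $\partial_t\varphi(s,t)+H^*(s,\partial_s\varphi(s,t))\ge 0$; - if $(W_{\bar T})_*-\varphi$ has a local minimum at $(s,t)$, then $\partial_t\varphi(s,t)+H_*(s,\partial_s\varphi(s,t))\le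 0$. Moreover, the same two implications hold with $W_{\bar T}$ and $H$ themselves in place of their envelopes. Finally, $W_{\bar T}(s,\bar T)=0$ for all $s$, and this value is attained continuously from $t\le\bar T$. -/

import Mathlib

open Set Filter Topology MeasureTheory

noncomputable section

namespace ReachGame

/-! ### Dynamics and running cost stopped at the target -/

section Dynamics

variable {E A B : Type*} [NormedAddCommGroup E] [NormedSpace ℝ E]

/-- The modified dynamics: `f s a b` for `s ∉ K` and `0` for `s ∈ K`. -/
def stoppedField (f : E → A → B → E) (K : Set E) (s : E) (a : A) (b : B) : E :=
  Kᶜ.indicator (fun x => f x a b) s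

/-- The modified running cost: `1` for `s ∉ K` and `0` for `s ∈ K`. -/
def outsideCost (K : Set E) (s : E) : ℝ :=
  Kᶜ.indicator (fun _ => (1 : ℝ)) s

/-- `x` is the trajectory on `[t, ∞)` of the modified system started from `s` at time `t` under the
inputs `a` and `b`: a Carathéodory solution (the differential equation in integrated form) that
stays where it is once it has touched `K`. The last clause is not a consequence of the integral
equation, because a curve may leave `K` through a boundary point at a single instant. -/
structure IsStoppedTrajectory (f : E → A → B → E) (K : Set E) (t : ℝ) (s : E)
    (a : ℝ → A) (b : ℝ → B) (x : ℝ → E) : Prop where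
  continuousOn : ContinuousOn x (Ici t)
  initial : x t = s
  integral_eq : ∀ r, t ≤ r → x r = s + ∫ u in t..r, stoppedField f K (x u) (a u) (b u)
  absorbed : ∀ r, t ≤ r → x r ∈ K → ∀ r', r ≤ r' → x r' = x r

end Dynamics

/-! ### Controls, nonanticipative strategies, value function -/

/-- Lebesgue measurable functions from `[t, ∞)` to `A`. They are represented by functions on `ℝ`;
their values before time `t` are unconstrained and play no role. -/
def Control (A : Type*) [MeasurableSpace A] (t : ℝ) : Type _ :=
  {a : ℝ → A // NullMeasurable a (volume.restrict (Ici t))}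

/-- `β` is nonanticipative: if two inputs agree a.e. on `[t, r]`, so do the responses. -/
def IsNonanticipative {A B : Type*} [MeasurableSpace A] [MeasurableSpace B] {t : ℝ}
    (β : Control A t → Control B t) : Prop :=
  ∀ r, t ≤ r → ∀ a a' : Control A t,
    (∀ᵐ u ∂(volume.restrict (Icc t r)), a.1 u = a'.1 u) →
      ∀ᵐ u ∂(volume.restrict (Icc t r)), (β a).1 u = (β a').1 u

/-- The nonanticipative strategies of Player II on `[t, ∞)`. -/
def Strategy (A B : Type*) [MeasurableSpace A] [MeasurableSpace B] (t : ℝ) : Type _ :=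
  {β : Control A t → Control B t // IsNonanticipative β}

/-- The value `sup_β inf_a ∫_t^T 𝕀(x(u)) du`, where `x` is the trajectory of the modified system
started from `s` at time `t` under the inputs `a` and `β[a]`. -/
def valueFunction {E A B : Type*} [NormedAddCommGroup E] [NormedSpace ℝ E]
    [MeasurableSpace A] [MeasurableSpace B]
    (f : E → A → B → E) (K : Set E) (T : ℝ) (s : E) (t : ℝ) : ℝ :=
  ⨆ β : Strategy A B t,
    ⨅ q : {q : Control A t × (ℝ → E) //
        IsStoppedTrajectory f K t s q.1.1 (β.1 q.1).1 q.2},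
      ∫ u in t..T, outsideCost K (q.1.2 u)

/-! ### The Hamilton-Jacobi equation and its viscosity solutions -/

/-- The Hamiltonian `H(s, p) = min_a max_b {𝕀(s) + p · f̂(s, a, b)}`. -/
def hamiltonian {E A B : Type*} [NormedAddCommGroup E] [NormedSpace ℝ E]
    (f : E → A → B → E) (K : Set E) (s : E) (p : E →L[ℝ] ℝ) : ℝ :=
  ⨅ a : A, ⨆ b : B, (outsideCost K s + p (stoppedField f K s a b))

/-- Upper semicontinuous envelope of a locally bounded function (the neighbourhood filter contains
the point itself). -/
def upperEnvelope {X : Type*} [TopologicalSpace X] (g : X → ℝ) (x : X) : ℝ :=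
  limsup g (𝓝 x)

/-- Lower semicontinuous envelope of a locally bounded function. -/
def lowerEnvelope {X : Type*} [TopologicalSpace X] (g : X → ℝ) (x : X) : ℝ :=
  liminf g (𝓝 x)

section Viscosity

variable {E : Type*} [NormedAddCommGroup E] [NormedSpace ℝ E]

/-- The time derivative of `φ` at `(s, t)`. -/
def timeDeriv (φ : E × ℝ → ℝ) (s : E) (t : ℝ) : ℝ :=
  deriv (fun r => φ (s, r)) t

/-- The spatial derivative of `φ` at `(s, t)`, as a row vector. -/
def spaceDeriv (φ : E × ℝ → ℝ) (s : E) (t : ℝ) : E →L[ℝ] ℝ :=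
  fderiv ℝ (fun x => φ (x, t)) s

/-- `u` is a (possibly discontinuous) viscosity solution, in the sense of semicontinuous envelopes,
of `∂ₜ u + H(s, ∂ₛ u) = 0` for `t < T`. The equation is posed backwards in time, so a subsolution
satisfies `∂ₜ φ + H ≥ 0` at a maximum of `u - φ`. -/
structure IsEnvelopeViscositySolution (H : E → (E →L[ℝ] ℝ) → ℝ) (T : ℝ) (u : E → ℝ → ℝ) :
    Prop where
  locallyBounded : ∀ s t, t < T → ∃ M, ∀ᶠ z in 𝓝 (s, t), |u z.1 z.2| ≤ M
  subsolution : ∀ φ : E × ℝ → ℝ, ContDiff ℝ 1 φ → ∀ s t, t < T →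
    IsLocalMax (fun z => upperEnvelope (fun y : E × ℝ => u y.1 y.2) z - φ z) (s, t) →
      0 ≤ timeDeriv φ s t
        + upperEnvelope (fun y : E × (E →L[ℝ] ℝ) => H y.1 y.2) (s, spaceDeriv φ s t)
  supersolution : ∀ φ : E × ℝ → ℝ, ContDiff ℝ 1 φ → ∀ s t, t < T →
    IsLocalMin (fun z => lowerEnvelope (fun y : E × ℝ => u y.1 y.2) z - φ z) (s, t) →
      timeDeriv φ s t
        + lowerEnvelope (fun y : E × (E →L[ℝ] ℝ) => H y.1 y.2) (s, spaceDeriv φ s t) ≤ 0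

/-- The viscosity inequalities for `∂ₜ u + H(s, ∂ₛ u) = 0`, `t < T`, with `u` and `H` themselves in
place of their envelopes. -/
structure IsTouchingViscositySolution (H : E → (E →L[ℝ] ℝ) → ℝ) (T : ℝ) (u : E → ℝ → ℝ) :
    Prop where
  subsolution : ∀ φ : E × ℝ → ℝ, ContDiff ℝ 1 φ → ∀ s t, t < T →
    IsLocalMax (fun z => u z.1 z.2 - φ z) (s, t) →
      0 ≤ timeDeriv φ s t + H s (spaceDeriv φ s t)
  supersolution : ∀ φ : E × ℝ → ℝ, ContDiff ℝ 1 φ → ∀ s t, t < T →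
    IsLocalMin (fun z => u z.1 z.2 - φ z) (s, t) →
      timeDeriv φ s t + H s (spaceDeriv φ s t) ≤ 0

/-- `u` takes the terminal value `0` at time `T`, and does so continuously from `t ≤ T`. -/
def HasZeroTerminalValue (T : ℝ) (u : E → ℝ → ℝ) : Prop :=
  ∀ s, u s T = 0 ∧
    ContinuousWithinAt (fun z : E × ℝ => u z.1 z.2) (univ ×ˢ Iic T) (s, T)

end Viscosity

end ReachGame

end

noncomputable section

set_option linter.unusedSectionVars false

namespace ReachGame

section IntegralEquation

/-! ### Integral equations with a measurable, Lipschitz and bounded right-hand side -/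

/-! The engine is dynamic programming over a short interval `[t, t']`. Against every strategy,
Player I may open with a prescribed control, so the value is at most running cost plus later value
along some trajectory (`exists_valueFunction_le_integral_add`). Player II may open with a measurable
feedback `γ` of the opponent's control, which gives the reverse bound along some trajectory
(`exists_integral_add_le_valueFunction`). Arbitrarily small errors replace attainment and measurable
selection. If a viscosity inequality fails at `(s, t)`, then near `s` either one constant control
makes `∂ₜφ + 𝕀 + ∂ₛφ · f̂` at most `-θ` against all responses, or one feedback makes it at least `θ`
against all controls. Integrating along trajectories shows that from every `z` near `(s, t)` there
is a nearby `z'` at which `W - φ` is larger (respectively smaller) by a gap `κ` independent of `z`.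
This contradicts the local extremum: taking `z = (s, t)` refutes the pointwise version, and the
uniform gap survives the passage to envelopes. The discontinuity at `∂K` matters only in choosing
the control or feedback. On `K` the integrand reduces to `∂ₜφ`, which the bound on the envelope of
`H` controls because `H = 0` there. In the pointwise version, points of `K` are settled directly
since `W` vanishes on `K`, and off `K` there is a neighbourhood free of `K`. -/

theorem eq_zero_of_le_mul_integral {D : ℝ → ℝ} {t r L : ℝ} (hD : Continuous D)
    (h0 : ∀ u, 0 ≤ D u) (h : ∀ u ∈ Icc t r, D u ≤ L * ∫ v in t..u, D v) :
    ∀ u ∈ Icc t r, D u = 0 := by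
  have hderiv : ∀ u, HasDerivAt (fun u => ∫ v in t..u, D v) (D u) u := fun u =>
    intervalIntegral.integral_hasDerivAt_right (hD.intervalIntegrable _ _)
      (hD.stronglyMeasurableAtFilter _ _) hD.continuousAt
  -- Grönwall is applied to the primitive of `D`, since `D` itself need not be differentiable.
  have hG : ∀ u ∈ Icc t r, ∫ v in t..u, D v = 0 := by
    apply eq_zero_of_abs_deriv_le_mul_abs_self_of_eq_zero_right (f' := D) (K := L)
    · exact fun u _ => (hderiv u).continuousAt.continuousWithinAt
    · exact fun u _ => (hderiv u).hasDerivWithinAt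
    · simp
    · intro u hu
      rw [Real.norm_of_nonneg (h0 u),
        Real.norm_of_nonneg (intervalIntegral.integral_nonneg hu.1 fun v _ => h0 v)]
      exact h u ⟨hu.1, hu.2.le⟩
  intro u hu
  have := h u hu
  rw [hG u hu, mul_zero] at this
  exact le_antisymm this (h0 u)

theorem intervalIntegrable_of_norm_le {G : Type*} [NormedAddCommGroup G] {t p q M : ℝ} {g : ℝ → G}
    (hg : AEStronglyMeasurable g (volume.restrict (Ici t))) (hM : ∀ u, ‖g u‖ ≤ M)
    (hp : t ≤ p) (hq : t ≤ q) : IntervalIntegrable g volume p q := by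
  rw [intervalIntegrable_iff]
  refine IntegrableOn.of_bound (by simp) ?_ M (ae_of_all _ hM)
  refine AEStronglyMeasurable.mono_set ?_ hg
  intro u hu
  exact (le_min hp hq).trans hu.1.le

variable {E : Type*} [NormedAddCommGroup E] [NormedSpace ℝ E]

/-- A time-dependent vector field on `[t, ∞)`, Lipschitz and bounded, and measurable along
continuous curves. -/
structure IsCaratheodoryField (t L M : ℝ) (F : ℝ → E → E) : Prop where
  lipschitz_nonneg : 0 ≤ L
  lipschitz : ∀ u x y, ‖F u x - F u y‖ ≤ L * ‖x - y‖
  bounded : ∀ u x, ‖F u x‖ ≤ M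
  aestronglyMeasurable : ∀ x : ℝ → E, ContinuousOn x (Ici t) →
    AEStronglyMeasurable (fun u => F u (x u)) (volume.restrict (Ici t))

/-- Freezing the upper limit at `t` to the left of `t` gives Lipschitz continuity on all of `ℝ`,
with a constant common to all Picard iterates. -/
theorem lipschitzWith_integral_max {t M : ℝ} {g : ℝ → E} (s : E)
    (hg : AEStronglyMeasurable g (volume.restrict (Ici t))) (hM : ∀ u, ‖g u‖ ≤ M) :
    LipschitzWith M.toNNReal (fun r => s + ∫ u in t..max t r, g u) := by
  have hM0 : 0 ≤ M := (norm_nonneg _).trans (hM 0)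
  refine LipschitzWith.of_dist_le_mul fun r q => ?_
  rw [dist_add_left, dist_eq_norm, intervalIntegral.integral_interval_sub_left
    (intervalIntegrable_of_norm_le hg hM le_rfl (le_max_left _ _))
    (intervalIntegrable_of_norm_le hg hM le_rfl (le_max_left _ _)), Real.coe_toNNReal _ hM0]
  refine (intervalIntegral.norm_integral_le_of_norm_le_const fun u _ => hM u).trans ?_
  gcongr
  rw [Real.dist_eq]
  rw [max_comm t, max_comm t]
  exact abs_max_sub_max_le_abs r q t

/-- The Picard iterates of the integral equation. -/
def picardIterate (F : ℝ → E → E) (t : ℝ) (s : E) : ℕ → ℝ → E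
  | 0 => fun _ => s
  | k + 1 => fun r => s + ∫ u in t..max t r, F u (picardIterate F t s k u)

namespace IsCaratheodoryField

variable {t L M : ℝ} {F : ℝ → E → E}

theorem intervalIntegrable (hF : IsCaratheodoryField t L M F) {x : ℝ → E}
    (hx : ContinuousOn x (Ici t)) {p q : ℝ} (hp : t ≤ p) (hq : t ≤ q) :
    IntervalIntegrable (fun u => F u (x u)) volume p q :=
  intervalIntegrable_of_norm_le (hF.aestronglyMeasurable x hx) (fun u => hF.bounded u (x u)) hp hq

theorem lipschitzWith_picardIterate (hF : IsCaratheodoryField t L M F) (s : E) (k : ℕ) :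
    LipschitzWith M.toNNReal (picardIterate F t s k) := by
  induction k with
  | zero => exact LipschitzWith.const' s
  | succ k ih =>
    exact lipschitzWith_integral_max s (hF.aestronglyMeasurable _ ih.continuous.continuousOn)
      fun u => hF.bounded u _

/-- Each integration raises the power of `r - t` by one; the resulting factorial makes the
increments summable on an unbounded time interval. -/
theorem norm_picardIterate_sub_le (hF : IsCaratheodoryField t L M F) (s : E) (k : ℕ) {r : ℝ}
    (hr : t ≤ r) :
    ‖picardIterate F t s (k + 1) r - picardIterate F t s k r‖
      ≤ M * L ^ k * ((r - t) ^ (k + 1) / (k + 1).factorial) := by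
  induction k generalizing r with
  | zero =>
    simp only [picardIterate, add_sub_cancel_left, max_eq_right hr]
    refine (intervalIntegral.norm_integral_le_of_norm_le_const fun u _ =>
      hF.bounded u s).trans ?_
    rw [abs_of_nonneg (sub_nonneg.2 hr)]
    simp
  | succ k ih =>
    have hc : ∀ k, ContinuousOn (picardIterate F t s k) (Ici t) := fun k =>
      (hF.lipschitzWith_picardIterate s k).continuous.continuousOn
    have e : picardIterate F t s (k + 2) r - picardIterate F t s (k + 1) r
        = ∫ u in t..r, (F u (picardIterate F t s (k + 1) u) - F u (picardIterate F t s k u)) := by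
      rw [intervalIntegral.integral_sub (hF.intervalIntegrable (hc _) le_rfl hr)
        (hF.intervalIntegrable (hc _) le_rfl hr)]
      simp only [picardIterate, max_eq_right hr, add_sub_add_left_eq_sub]
    rw [e]
    have hle : ∀ u ∈ Ioc t r,
        ‖F u (picardIterate F t s (k + 1) u) - F u (picardIterate F t s k u)‖
          ≤ L * (M * L ^ k * ((u - t) ^ (k + 1) / (k + 1).factorial)) := fun u hu =>
      (hF.lipschitz _ _ _).trans (mul_le_mul_of_nonneg_left (ih hu.1.le) hF.lipschitz_nonneg)
    refine (intervalIntegral.norm_integral_le_of_norm_le hr (ae_of_all _ hle)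
      (Continuous.intervalIntegrable (by fun_prop) _ _)).trans (le_of_eq ?_)
    have hi : ∫ u in t..r, (u - t) ^ (k + 1) = (r - t) ^ (k + 2) / (k + 2) := by
      rw [intervalIntegral.integral_comp_sub_right (fun u => u ^ (k + 1)) t, integral_pow]
      simp; ring
    simp only [intervalIntegral.integral_const_mul, intervalIntegral.integral_div, hi]
    rw [Nat.factorial_succ (k + 1)]
    have : ((k + 1).factorial : ℝ) ≠ 0 := by positivity
    push_cast
    field_simp
    ring

/-- Pointwise convergence of the Picard iterates suffices: the common Lipschitz constant passes to
the limit, and dominated convergence passes the integral equation to it. -/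
theorem exists_solution [CompleteSpace E] (hF : IsCaratheodoryField t L M F) (s : E) :
    ∃ y : ℝ → E, Continuous y ∧ ∀ r, t ≤ r → y r = s + ∫ u in t..r, F u (y u) := by
  have hconv : ∀ r, t ≤ r → ∃ z, Tendsto (fun k => picardIterate F t s k r) atTop (𝓝 z) := by
    intro r hr
    refine cauchySeq_tendsto_of_complete (cauchySeq_of_dist_le_of_summable
      (fun k => M * L ^ k * ((r - t) ^ (k + 1) / (k + 1).factorial)) (fun k => ?_) ?_)
    · rw [dist_comm, dist_eq_norm]
      exact hF.norm_picardIterate_sub_le s k hr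
    · have h1 := (Real.summable_pow_div_factorial (L * (r - t))).mul_left (M * (r - t))
      refine Summable.of_nonneg_of_le (fun k => ?_) (fun k => ?_) h1
      · have := (norm_nonneg _).trans (hF.bounded 0 0)
        have := hF.lipschitz_nonneg
        have := sub_nonneg.2 hr
        positivity
      · have hM := (norm_nonneg _).trans (hF.bounded 0 0)
        have hL := hF.lipschitz_nonneg
        have ht := sub_nonneg.2 hr
        calc M * L ^ k * ((r - t) ^ (k + 1) / (k + 1).factorial)
            ≤ M * L ^ k * ((r - t) ^ (k + 1) / k.factorial) := by
              gcongr
              exact Nat.le_succ k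
          _ = _ := by rw [mul_pow]; ring
  choose! z hz using hconv
  have hzc : LipschitzOnWith M.toNNReal z (Ici t) := by
    refine LipschitzOnWith.of_dist_le_mul fun r hr q hq => ?_
    exact le_of_tendsto ((hz r hr).dist (hz q hq)) (Eventually.of_forall fun k =>
      (hF.lipschitzWith_picardIterate s k).dist_le_mul r q)
  have hzeq : ∀ r, t ≤ r → z r = s + ∫ u in t..r, F u (z u) := by
    intro r hr
    have h1 : Tendsto (fun k => picardIterate F t s (k + 1) r) atTop
        (𝓝 (s + ∫ u in t..r, F u (z u))) := by
      simp only [picardIterate, max_eq_right hr]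
      refine Tendsto.const_add s (intervalIntegral.tendsto_integral_filter_of_dominated_convergence
        (fun _ => M) (Eventually.of_forall fun k => ?_) (Eventually.of_forall fun k =>
          ae_of_all _ fun u _ => hF.bounded u _) (by simp) (ae_of_all _ fun u hu => ?_))
      · exact (hF.intervalIntegrable (hF.lipschitzWith_picardIterate s k).continuous.continuousOn
          le_rfl hr).def'.aestronglyMeasurable
      · rw [uIoc_of_le hr] at hu
        have hcont : Continuous (F u) := by
          refine (LipschitzWith.of_dist_le_mul (K := L.toNNReal) fun x y => ?_).continuous
          rw [Real.coe_toNNReal _ hF.lipschitz_nonneg, dist_eq_norm, dist_eq_norm]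
          exact hF.lipschitz u x y
        exact (hcont.tendsto _).comp (hz u hu.1.le)
    exact tendsto_nhds_unique ((tendsto_add_atTop_iff_nat 1).2 (hz r hr)) h1
  -- The limit is controlled only on `[t, ∞)`; freezing it before `t` yields a globally continuous
  -- curve.
  refine ⟨fun r => z (max t r), ?_, fun r hr => ?_⟩
  · exact hzc.continuousOn.comp_continuous (by fun_prop) fun r => le_max_left t r
  · simp only [max_eq_right hr]
    rw [hzeq r hr]
    congr 1
    refine intervalIntegral.integral_congr fun u hu => ?_
    rw [uIcc_of_le hr] at hu
    simp only [max_eq_right hu.1]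

/-- Solutions for almost everywhere equal vector fields coincide. -/
theorem solution_unique {F' : ℝ → E → E} (hF : IsCaratheodoryField t L M F)
    (hF' : IsCaratheodoryField t L M F') {s : E} {x y : ℝ → E} {r : ℝ}
    (hFF' : ∀ᵐ u ∂(volume.restrict (Icc t r)), F u = F' u)
    (hx : ContinuousOn x (Ici t)) (hy : ContinuousOn y (Ici t))
    (hxeq : ∀ u ∈ Icc t r, x u = s + ∫ v in t..u, F v (x v))
    (hyeq : ∀ u ∈ Icc t r, y u = s + ∫ v in t..u, F' v (y v)) :
    ∀ u ∈ Icc t r, x u = y u := by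
  have hD : Continuous fun u => ‖x (max t u) - y (max t u)‖ := by
    have h := fun (z : ℝ → E) (hz : ContinuousOn z (Ici t)) =>
      hz.comp_continuous (f := fun u => max t u) (by fun_prop) fun u => le_max_left t u
    exact ((h x hx).sub (h y hy)).norm
  have key := eq_zero_of_le_mul_integral (t := t) (L := L) (r := r) hD (fun _ => norm_nonneg _) ?_
  · intro u hu
    have := key u hu
    rwa [max_eq_right hu.1, norm_eq_zero, sub_eq_zero] at this
  intro u hu
  rw [max_eq_right hu.1, hxeq u hu, hyeq u hu, add_sub_add_left_eq_sub,
    ← intervalIntegral.integral_sub (hF.intervalIntegrable hx le_rfl hu.1)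
    (hF'.intervalIntegrable hy le_rfl hu.1), ← intervalIntegral.integral_const_mul]
  refine intervalIntegral.norm_integral_le_of_norm_le hu.1 ?_
    (Continuous.intervalIntegrable (by fun_prop) _ _)
  rw [ae_restrict_iff' measurableSet_Icc] at hFF'
  filter_upwards [hFF'] with v hv hvu
  rw [← hv ⟨hvu.1.le, hvu.2.trans hu.2⟩, max_eq_right hvu.1.le]
  exact hF.lipschitz v _ _

end IsCaratheodoryField

end IntegralEquation

/-! ### Existence, uniqueness and elementary properties of stopped trajectories -/

section Trajectories

variable {E A B : Type*} [NormedAddCommGroup E] [NormedSpace ℝ E]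
  {f : E → A → B → E} {K : Set E} {L : NNReal} {M t : ℝ} {s : E}
  {a a' : ℝ → A} {b b' : ℝ → B} {x x' : ℝ → E}

theorem stoppedField_of_mem (hs : s ∈ K) (a : A) (b : B) : stoppedField f K s a b = 0 :=
  indicator_of_notMem (not_not_intro hs) _

theorem stoppedField_of_notMem (hs : s ∉ K) (a : A) (b : B) : stoppedField f K s a b = f s a b :=
  indicator_of_mem hs _

theorem outsideCost_of_mem (hs : s ∈ K) : outsideCost K s = 0 :=
  indicator_of_notMem (not_not_intro hs) _

theorem outsideCost_of_notMem (hs : s ∉ K) : outsideCost K s = 1 :=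
  indicator_of_mem (show s ∈ Kᶜ from hs) _

theorem outsideCost_nonneg (s : E) : 0 ≤ outsideCost K s :=
  indicator_nonneg (fun _ _ => zero_le_one) _

theorem outsideCost_le_one (s : E) : outsideCost K s ≤ 1 :=
  indicator_le_self' (fun _ _ => zero_le_one) _

theorem norm_stoppedField_le (hM : ∀ s a b, ‖f s a b‖ ≤ M) (s : E) (a : A) (b : B) :
    ‖stoppedField f K s a b‖ ≤ M :=
  (norm_indicator_le_norm_self _ _).trans (hM s a b)

theorem aestronglyMeasurable_indicator_compl_comp {G : Type*} [NormedAddCommGroup G]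
    (hK : IsClosed K) (hx : ContinuousOn x (Ici t)) {g : ℝ → G}
    (hg : AEStronglyMeasurable g (volume.restrict (Ici t))) :
    AEStronglyMeasurable (fun u => Kᶜ.indicator (fun _ => g u) (x u))
      (volume.restrict (Ici t)) := by
  have hc : Continuous fun u => x (max t u) :=
    hx.comp_continuous (f := fun u => max t u) (by fun_prop) fun u => le_max_left t u
  refine (hg.indicator (hK.isOpen_compl.preimage hc).measurableSet).congr ?_
  refine (ae_restrict_mem measurableSet_Ici).mono fun u hu => ?_
  have : max t u = u := max_eq_right hu
  by_cases h : x u ∈ K <;> simp [indicator, this, h]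

theorem intervalIntegrable_outsideCost (hK : IsClosed K) (hx : ContinuousOn x (Ici t)) {p q : ℝ}
    (hp : t ≤ p) (hq : t ≤ q) : IntervalIntegrable (fun u => outsideCost K (x u)) volume p q :=
  intervalIntegrable_of_norm_le (M := 1)
    (aestronglyMeasurable_indicator_compl_comp hK hx aestronglyMeasurable_const)
    (fun u => by
      rw [Real.norm_of_nonneg (outsideCost_nonneg _)]
      exact outsideCost_le_one _) hp hq

section Measurable

variable [MetricSpace A] [SecondCountableTopology A] [MeasurableSpace A] [BorelSpace A]
  [MetricSpace B] [SecondCountableTopology B] [MeasurableSpace B] [BorelSpace B]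
  [SecondCountableTopology E]

theorem isCaratheodoryField (hL : LipschitzWith L fun z : E × A × B => f z.1 z.2.1 z.2.2)
    (hM : ∀ s a b, ‖f s a b‖ ≤ M) (ha : NullMeasurable a (volume.restrict (Ici t)))
    (hb : NullMeasurable b (volume.restrict (Ici t))) :
    IsCaratheodoryField t L M fun u x => f x (a u) (b u) where
  lipschitz_nonneg := L.2
  lipschitz u x y := by
    have := hL.dist_le_mul (x, a u, b u) (y, a u, b u)
    simpa [Prod.dist_eq, dist_eq_norm] using this
  bounded u x := hM _ _ _
  aestronglyMeasurable x hx := by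
    rcases isEmpty_or_nonempty A with hA | hA
    · exact (hA.false (a 0)).elim
    rcases isEmpty_or_nonempty B with hB | hB
    · exact (hB.false (b 0)).elim
    exact hL.continuous.comp_aestronglyMeasurable
      ((hx.aestronglyMeasurable measurableSet_Ici).prodMk
        (ha.aemeasurable.aestronglyMeasurable.prodMk hb.aemeasurable.aestronglyMeasurable))

theorem intervalIntegrable_stoppedField (hK : IsClosed K)
    (hL : LipschitzWith L fun z : E × A × B => f z.1 z.2.1 z.2.2)
    (hM : ∀ s a b, ‖f s a b‖ ≤ M) (ha : NullMeasurable a (volume.restrict (Ici t)))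
    (hb : NullMeasurable b (volume.restrict (Ici t))) (hx : ContinuousOn x (Ici t)) {p q : ℝ}
    (hp : t ≤ p) (hq : t ≤ q) :
    IntervalIntegrable (fun u => stoppedField f K (x u) (a u) (b u)) volume p q :=
  intervalIntegrable_of_norm_le
    ((aestronglyMeasurable_indicator_compl_comp hK hx
      ((isCaratheodoryField hL hM ha hb).aestronglyMeasurable x hx)).congr
        (ae_of_all _ fun _ => rfl))
    (fun _ => norm_stoppedField_le hM _ _ _) hp hq

/-- Solve the unmodified equation and freeze the solution at its first hitting time of `K`, which is
attained because `K` is closed. -/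
theorem exists_isStoppedTrajectory [CompleteSpace E] (hK : IsClosed K)
    (hL : LipschitzWith L fun z : E × A × B => f z.1 z.2.1 z.2.2)
    (hM : ∀ s a b, ‖f s a b‖ ≤ M) (ha : NullMeasurable a (volume.restrict (Ici t)))
    (hb : NullMeasurable b (volume.restrict (Ici t))) (s : E) :
    ∃ x, IsStoppedTrajectory f K t s a b x := by
  obtain ⟨y, hyc, hy⟩ := (isCaratheodoryField hL hM ha hb).exists_solution s
  by_cases hhit : ∃ r, t ≤ r ∧ y r ∈ K
  · set S : Set ℝ := {r | t ≤ r ∧ y r ∈ K}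
    have hSbdd : BddBelow S := ⟨t, fun r hr => hr.1⟩
    have hSc : IsClosed S := isClosed_Ici.inter (hK.preimage hyc)
    obtain ⟨hτt, hτK⟩ : sInf S ∈ S := hSc.csInf_mem hhit hSbdd
    set τ := sInf S
    have hlt : ∀ u, t ≤ u → u < τ → y u ∉ K := fun u htu hu hK' =>
      (csInf_le hSbdd (show u ∈ S from ⟨htu, hK'⟩)).not_gt hu
    refine ⟨fun r => y (min r τ), (hyc.comp (by fun_prop)).continuousOn, ?_, ?_, ?_⟩
    · simp only [min_eq_left hτt]
      rw [hy t le_rfl]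
      simp
    · intro r hr
      rw [hy _ (le_min hr hτt), intervalIntegral.integral_of_le hr,
        intervalIntegral.integral_of_le (le_min hr hτt)]
      congr 1
      have h1 : ∀ u ∈ Ioc t r, stoppedField f K (y (min u τ)) (a u) (b u)
          = (Iio τ).indicator (fun u => f (y u) (a u) (b u)) u := by
        intro u hu
        rcases lt_or_ge u τ with h | h
        · rw [min_eq_left h.le, stoppedField_of_notMem (hlt u hu.1.le h),
            indicator_of_mem (show u ∈ Iio τ from h)]
        · rw [min_eq_right h, stoppedField_of_mem hτK, indicator_of_notMem (by simpa using h)]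
      rw [setIntegral_congr_fun measurableSet_Ioc h1, setIntegral_indicator measurableSet_Iio]
      refine setIntegral_congr_set ?_
      have h2 : Ioc t (min r τ) = Ioc t r ∩ Iic τ := by
        ext u; simp
      rw [h2]
      exact (ae_eq_refl _).inter Iio_ae_eq_Iic.symm
    · intro r hr hrK r' hr'
      have : τ ≤ r := by
        by_contra! h
        simp only [min_eq_left h.le] at hrK
        exact hlt r hr h hrK
      simp only [min_eq_right this, min_eq_right (this.trans hr')]
  · push Not at hhit
    refine ⟨y, hyc.continuousOn, ?_, ?_, fun r hr hrK => absurd hrK (hhit r hr)⟩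
    · rw [hy t le_rfl]
      simp
    · intro r hr
      rw [hy r hr]
      congr 1
      refine intervalIntegral.integral_congr fun u hu => ?_
      rw [uIcc_of_le hr] at hu
      exact (stoppedField_of_notMem (hhit u hu.1) _ _).symm

/-- The curve may lie in `K` at time `q` itself, but a single instant does not affect the integral.
-/
theorem IsStoppedTrajectory.eq_integral_of_notMem (hx : IsStoppedTrajectory f K t s a b x) {q : ℝ}
    (hq : ∀ u, t ≤ u → u < q → x u ∉ K) :
    ∀ u ∈ Icc t q, x u = s + ∫ v in t..u, f (x v) (a v) (b v) := by
  intro u hu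
  rw [hx.integral_eq u hu.1]
  congr 1
  refine intervalIntegral.integral_congr_ae ?_
  filter_upwards [Measure.ae_ne volume u] with v hvu hv
  rw [uIoc_of_le hu.1] at hv
  exact stoppedField_of_notMem (hq v hv.1.le (lt_of_lt_of_le (lt_of_le_of_ne hv.2 hvu) hu.2)) _ _

/-- The stopped field is not Lipschitz across `∂K`, so Grönwall is used only up to the first time
`τ` at which either curve meets `K`. The curves agree at `τ`, hence both are in `K` there, and
absorption keeps them equal afterwards. -/
theorem IsStoppedTrajectory.eqOn (hK : IsClosed K)
    (hL : LipschitzWith L fun z : E × A × B => f z.1 z.2.1 z.2.2)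
    (hM : ∀ s a b, ‖f s a b‖ ≤ M) (ha : NullMeasurable a (volume.restrict (Ici t)))
    (hb : NullMeasurable b (volume.restrict (Ici t)))
    (ha' : NullMeasurable a' (volume.restrict (Ici t)))
    (hb' : NullMeasurable b' (volume.restrict (Ici t)))
    (hx : IsStoppedTrajectory f K t s a b x) (hx' : IsStoppedTrajectory f K t s a' b' x') {r : ℝ}
    (haa' : ∀ᵐ u ∂(volume.restrict (Icc t r)), a u = a' u)
    (hbb' : ∀ᵐ u ∂(volume.restrict (Icc t r)), b u = b' u) :
    EqOn x x' (Icc t r) := by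
  have free : ∀ q ≤ r, (∀ u, t ≤ u → u < q → x u ∉ K) → (∀ u, t ≤ u → u < q → x' u ∉ K) →
      EqOn x x' (Icc t q) := by
    intro q hqr h h'
    refine (isCaratheodoryField hL hM ha hb).solution_unique (isCaratheodoryField hL hM ha' hb')
      ?_ hx.continuousOn hx'.continuousOn (hx.eq_integral_of_notMem h)
      (hx'.eq_integral_of_notMem h')
    refine ae_restrict_of_ae_restrict_of_subset (Icc_subset_Icc_right hqr) ?_
    filter_upwards [haa', hbb'] with u h1 h2
    rw [h1, h2]
  set S : Set ℝ := Icc t r ∩ x ⁻¹' K ∪ Icc t r ∩ x' ⁻¹' K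
  have hSc : IsCompact S := by
    have h := fun (z : ℝ → E) (hz : ContinuousOn z (Ici t)) =>
      (hz.mono fun (u : ℝ) (hu : u ∈ Icc t r) => hu.1).preimage_isClosed_of_isClosed isClosed_Icc hK
    refine (isCompact_Icc (a := t) (b := r)).of_isClosed_subset ((h x hx.continuousOn).union (h x' hx'.continuousOn)) ?_
    exact union_subset inter_subset_left inter_subset_left
  rcases S.eq_empty_or_nonempty with hemp | hne
  · have hno : ∀ u ∈ Icc t r, x u ∉ K ∧ x' u ∉ K := by
      intro u hu
      have : u ∉ S := by rw [hemp]; exact notMem_empty u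
      exact ⟨fun h => this (Or.inl ⟨hu, h⟩), fun h => this (Or.inr ⟨hu, h⟩)⟩
    exact free r le_rfl (fun u h1 h2 => (hno u ⟨h1, h2.le⟩).1)
      fun u h1 h2 => (hno u ⟨h1, h2.le⟩).2
  · obtain ⟨τ, hτS, hτ⟩ := hSc.exists_isLeast hne
    have hτI : τ ∈ Icc t r := hτS.elim And.left And.left
    have heq := free τ hτI.2
      (fun u h1 h2 h3 => (hτ (Or.inl ⟨⟨h1, h2.le.trans hτI.2⟩, h3⟩)).not_gt h2)
      (fun u h1 h2 h3 => (hτ (Or.inr ⟨⟨h1, h2.le.trans hτI.2⟩, h3⟩)).not_gt h2)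
    have hττ : x τ = x' τ := heq ⟨hτI.1, le_rfl⟩
    have hxK : x τ ∈ K := hτS.elim And.right fun h => by
      rw [hττ]; exact h.2
    intro u hu
    rcases le_total u τ with h | h
    · exact heq ⟨hu.1, h⟩
    · rw [hx.absorbed τ hτI.1 hxK u h, hx'.absorbed τ hτI.1 (hττ ▸ hxK) u h, hττ]

theorem IsStoppedTrajectory.restart (hK : IsClosed K)
    (hL : LipschitzWith L fun z : E × A × B => f z.1 z.2.1 z.2.2)
    (hM : ∀ s a b, ‖f s a b‖ ≤ M) (ha : NullMeasurable a (volume.restrict (Ici t)))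
    (hb : NullMeasurable b (volume.restrict (Ici t)))
    (hx : IsStoppedTrajectory f K t s a b x) {t' : ℝ} (ht : t ≤ t')
    (haa' : EqOn a a' (Ici t')) (hbb' : EqOn b b' (Ici t')) :
    IsStoppedTrajectory f K t' (x t') a' b' x where
  continuousOn := hx.continuousOn.mono (Ici_subset_Ici.2 ht)
  initial := rfl
  integral_eq r hr := by
    have hi := fun {p q : ℝ} (hp : t ≤ p) (hq : t ≤ q) =>
      intervalIntegrable_stoppedField hK hL hM ha hb hx.continuousOn hp hq
    rw [hx.integral_eq r (ht.trans hr), hx.integral_eq t' ht,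
      ← intervalIntegral.integral_add_adjacent_intervals (hi le_rfl ht) (hi ht (ht.trans hr)),
      add_assoc]
    congr 2
    refine intervalIntegral.integral_congr fun u hu => ?_
    rw [uIcc_of_le hr] at hu
    simp only [haa' hu.1, hbb' hu.1]
  absorbed r hr := hx.absorbed r (ht.trans hr)

end Measurable

theorem IsStoppedTrajectory.norm_sub_le (hM : ∀ s a b, ‖f s a b‖ ≤ M)
    (hx : IsStoppedTrajectory f K t s a b x) {r : ℝ} (hr : t ≤ r) : ‖x r - s‖ ≤ M * (r - t) := by
  rw [hx.integral_eq r hr, add_sub_cancel_left]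
  refine (intervalIntegral.norm_integral_le_of_norm_le_const fun u _ =>
    norm_stoppedField_le hM _ _ _).trans ?_
  rw [abs_of_nonneg (sub_nonneg.2 hr)]

theorem integral_outsideCost_nonneg (x : ℝ → E) {p q : ℝ} (h : p ≤ q) :
    0 ≤ ∫ u in p..q, outsideCost K (x u) :=
  intervalIntegral.integral_nonneg h fun _ _ => outsideCost_nonneg _

theorem abs_integral_outsideCost_le (x : ℝ → E) (p q : ℝ) :
    |∫ u in p..q, outsideCost K (x u)| ≤ |q - p| := by
  have := intervalIntegral.norm_integral_le_of_norm_le_const (a := p) (b := q) (C := 1)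
    (f := fun u => outsideCost K (x u)) fun u _ => by
      rw [Real.norm_of_nonneg (outsideCost_nonneg _)]
      exact outsideCost_le_one _
  simpa using this

end Trajectories

/-! ### Operations on controls -/

namespace Control

variable {A B : Type*} [MeasurableSpace A] [MeasurableSpace B] {t t' : ℝ}

/-- The constant control. -/
def const (a : A) : Control A t := ⟨fun _ => a, measurable_const.nullMeasurable⟩

/-- The restriction of a control to a later time interval. -/
def shift (ht : t ≤ t') (a : Control A t) : Control A t' :=
  ⟨a.1, fun _ hs => (a.2 hs).mono_ac
    (Measure.restrict_mono (Ici_subset_Ici.2 ht) le_rfl).absolutelyContinuous⟩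

/-- The image of a control under a measurable map. -/
def map (γ : A → B) (hγ : Measurable γ) (a : Control A t) : Control B t :=
  ⟨γ ∘ a.1, hγ.comp_nullMeasurable a.2⟩

variable [MetricSpace A] [SecondCountableTopology A] [BorelSpace A] [Nonempty A]

/-- The control that follows `a` before time `t'` and `c` from time `t'` on. -/
def concat (a : Control A t) (c : Control A t') : Control A t :=
  ⟨fun u => if u < t' then a.1 u else c.1 u, by
    have hsub : Ici t ⊆ (Ici t ∩ Iio t') ∪ Ici t' := fun u hu =>
      (lt_or_ge u t').imp (fun h => ⟨hu, h⟩) id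
    refine (AEMeasurable.mono_set hsub (aemeasurable_union_iff.2 ⟨?_, ?_⟩)).nullMeasurable
    · refine (a.2.aemeasurable.mono_set inter_subset_left).congr ?_
      exact (ae_restrict_mem (measurableSet_Ici.inter measurableSet_Iio)).mono fun u hu =>
        (if_pos hu.2).symm
    · refine c.2.aemeasurable.congr ?_
      exact (ae_restrict_mem measurableSet_Ici).mono fun u hu =>
        (if_neg (not_lt.2 hu)).symm⟩

theorem concat_apply_of_lt (a : Control A t) (c : Control A t') {u : ℝ} (hu : u < t') :
    (concat a c).1 u = a.1 u :=
  if_pos hu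

theorem concat_apply_of_le (a : Control A t) (c : Control A t') {u : ℝ} (hu : t' ≤ u) :
    (concat a c).1 u = c.1 u :=
  if_neg (not_lt.2 hu)

end Control

theorem ae_Icc_of_forall_lt {t t' : ℝ} {p : ℝ → Prop} (h : ∀ u < t', p u) :
    ∀ᵐ u ∂(volume.restrict (Icc t t')), p u := by
  rw [ae_restrict_iff' measurableSet_Icc]
  filter_upwards [Measure.ae_ne volume t'] with u hu hut
  exact h u (lt_of_le_of_ne hut.2 hu)

/-- The standing assumptions on the dynamics and the target. -/
structure IsRegularGame {E A B : Type*} [NormedAddCommGroup E] [MetricSpace A] [MetricSpace B]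
    (f : E → A → B → E) (K : Set E) (L : NNReal) (M : ℝ) : Prop where
  isClosed : IsClosed K
  lipschitz : LipschitzWith L fun z : E × A × B => f z.1 z.2.1 z.2.2
  bounded : ∀ s a b, ‖f s a b‖ ≤ M

/-! ### Payoffs, elementary bounds on the value, dynamic programming -/

section Value

variable {E A B : Type*} [NormedAddCommGroup E] [NormedSpace ℝ E]
  [MetricSpace A] [SecondCountableTopology A] [MeasurableSpace A] [BorelSpace A] [Nonempty A]
  [MetricSpace B] [SecondCountableTopology B] [MeasurableSpace B] [BorelSpace B] [Nonempty B]
  {f : E → A → B → E} {K : Set E} {L : NNReal} {M : ℝ} {T t t' : ℝ} {s : E}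

instance : Nonempty (Strategy A B t) :=
  ⟨⟨fun _ => Control.const (Classical.arbitrary B), fun _ _ _ _ _ => ae_of_all _ fun _ => rfl⟩⟩

/-- The payoff that the strategy `β` guarantees to Player II. -/
def guaranteedPayoff (f : E → A → B → E) (K : Set E) (T : ℝ) (s : E) (t : ℝ)
    (β : Strategy A B t) : ℝ :=
  ⨅ q : {q : Control A t × (ℝ → E) // IsStoppedTrajectory f K t s q.1.1 (β.1 q.1).1 q.2},
    ∫ u in t..T, outsideCost K (q.1.2 u)

theorem guaranteedPayoff_le (β : Strategy A B t) (a : Control A t) {x : ℝ → E}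
    (hx : IsStoppedTrajectory f K t s a.1 (β.1 a).1 x) :
    guaranteedPayoff f K T s t β ≤ ∫ u in t..T, outsideCost K (x u) :=
  ciInf_le (f := fun q : {q : Control A t × (ℝ → E) //
      IsStoppedTrajectory f K t s q.1.1 (β.1 q.1).1 q.2} => ∫ u in t..T, outsideCost K (q.1.2 u))
    ⟨-|T - t|, by
      rintro _ ⟨q, rfl⟩
      exact (abs_le.1 (abs_integral_outsideCost_le _ _ _)).1⟩ ⟨(a, x), hx⟩

/-- Existence of trajectories makes the index set of the infimum nonempty, so the real infimum is
not a default value. -/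
theorem exists_integral_lt_guaranteedPayoff_add [CompleteSpace E] [SecondCountableTopology E]
    (hG : IsRegularGame f K L M) (β : Strategy A B t) {ε : ℝ} (hε : 0 < ε) :
    ∃ (a : Control A t) (x : ℝ → E), IsStoppedTrajectory f K t s a.1 (β.1 a).1 x ∧
      ∫ u in t..T, outsideCost K (x u) < guaranteedPayoff f K T s t β + ε := by
  obtain ⟨x, hx⟩ := exists_isStoppedTrajectory hG.isClosed hG.lipschitz hG.bounded
    (Control.const (t := t) (Classical.arbitrary A)).2
    (β.1 (Control.const (Classical.arbitrary A))).2 s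
  have : Nonempty {q : Control A t × (ℝ → E) //
      IsStoppedTrajectory f K t s q.1.1 (β.1 q.1).1 q.2} := ⟨⟨(_, x), hx⟩⟩
  obtain ⟨⟨⟨a, y⟩, hy⟩, hlt⟩ := exists_lt_of_ciInf_lt (lt_add_of_pos_right
    (guaranteedPayoff f K T s t β) hε)
  exact ⟨a, y, hy, hlt⟩

theorem abs_guaranteedPayoff_le [CompleteSpace E] [SecondCountableTopology E]
    (hG : IsRegularGame f K L M) (β : Strategy A B t) :
    |guaranteedPayoff f K T s t β| ≤ |T - t| := by
  refine abs_le.2 ⟨le_of_forall_pos_lt_add fun ε hε => ?_, ?_⟩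
  · obtain ⟨a, x, -, h⟩ := exists_integral_lt_guaranteedPayoff_add (T := T) (s := s) hG β hε
    exact (abs_le.1 (abs_integral_outsideCost_le _ _ _)).1.trans_lt h
  · obtain ⟨a, x, hx, -⟩ := exists_integral_lt_guaranteedPayoff_add (T := T) (s := s) hG β one_pos
    exact (guaranteedPayoff_le β a hx).trans (abs_le.1 (abs_integral_outsideCost_le _ _ _)).2

variable [CompleteSpace E] [SecondCountableTopology E]

theorem guaranteedPayoff_le_valueFunction (hG : IsRegularGame f K L M) (β : Strategy A B t) :
    guaranteedPayoff f K T s t β ≤ valueFunction f K T s t :=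
  le_ciSup (f := fun β => guaranteedPayoff f K T s t β)
    ⟨|T - t|, by
      rintro _ ⟨β, rfl⟩
      exact (abs_le.1 (abs_guaranteedPayoff_le hG β)).2⟩ β

theorem exists_valueFunction_lt_guaranteedPayoff_add (f : E → A → B → E) (K : Set E) (T : ℝ)
    (s : E) (t : ℝ) {ε : ℝ} (hε : 0 < ε) :
    ∃ β : Strategy A B t, valueFunction f K T s t < guaranteedPayoff f K T s t β + ε := by
  obtain ⟨β, hβ⟩ := exists_lt_of_lt_ciSup (sub_lt_self (valueFunction f K T s t) hε)
  exact ⟨β, sub_lt_iff_lt_add.1 hβ⟩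

theorem valueFunction_nonneg (hG : IsRegularGame f K L M) (ht : t ≤ T) :
    0 ≤ valueFunction f K T s t := by
  refine le_trans ?_ (guaranteedPayoff_le_valueFunction hG (Classical.arbitrary _))
  exact Real.iInf_nonneg fun q => integral_outsideCost_nonneg _ ht

theorem valueFunction_le (hG : IsRegularGame f K L M) (ht : t ≤ T) :
    valueFunction f K T s t ≤ T - t :=
  ciSup_le fun β => (le_abs_self _).trans <| (abs_guaranteedPayoff_le hG β).trans_eq
    (abs_of_nonneg (sub_nonneg.2 ht))

theorem valueFunction_eq_zero_of_mem (hG : IsRegularGame f K L M) (hs : s ∈ K) (ht : t ≤ T) :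
    valueFunction f K T s t = 0 := by
  refine le_antisymm (ciSup_le fun β => ?_) (valueFunction_nonneg hG ht)
  obtain ⟨a, x, hx, -⟩ := exists_integral_lt_guaranteedPayoff_add (T := T) (s := s) hG β one_pos
  refine (guaranteedPayoff_le β a hx).trans (le_of_eq ?_)
  refine intervalIntegral.integral_zero_ae (ae_of_all _ fun u hu => outsideCost_of_mem ?_)
  rw [uIoc_of_le ht] at hu
  rw [hx.absorbed t le_rfl (hx.initial ▸ hs) u hu.1.le, hx.initial]
  exact hs

theorem IsStoppedTrajectory.integral_outsideCost_split (hG : IsRegularGame f K L M)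
    {a : ℝ → A} {b : ℝ → B} {x : ℝ → E} (hx : IsStoppedTrajectory f K t s a b x)
    (ht : t ≤ t') (hT : t' ≤ T) :
    ∫ u in t..T, outsideCost K (x u)
      = (∫ u in t..t', outsideCost K (x u)) + ∫ u in t'..T, outsideCost K (x u) :=
  (intervalIntegral.integral_add_adjacent_intervals
    (intervalIntegrable_outsideCost hG.isClosed hx.continuousOn le_rfl ht)
    (intervalIntegrable_outsideCost hG.isClosed hx.continuousOn ht (ht.trans hT))).symm

/-! ### The two halves of the dynamic programming principle -/

/-- Player I may start with any control `a₀` before time `t'`. -/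
theorem exists_valueFunction_le_integral_add (hG : IsRegularGame f K L M) (ht : t ≤ t')
    (hT : t' ≤ T) (s : E) (a₀ : Control A t) {ε : ℝ} (hε : 0 < ε) :
    ∃ (a : Control A t) (b : Control B t) (x : ℝ → E), (∀ u < t', a.1 u = a₀.1 u) ∧
      IsStoppedTrajectory f K t s a.1 b.1 x ∧
      valueFunction f K T s t
        ≤ (∫ u in t..t', outsideCost K (x u)) + valueFunction f K T (x t') t' + ε := by
  obtain ⟨β, hβ⟩ := exists_valueFunction_lt_guaranteedPayoff_add f K T s t (half_pos hε)
  have hcc : ∀ r, t' ≤ r → ∀ c c' : Control A t',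
      (∀ᵐ u ∂(volume.restrict (Icc t' r)), c.1 u = c'.1 u) →
      ∀ᵐ u ∂(volume.restrict (Icc t r)),
        (Control.concat a₀ c).1 u = (Control.concat a₀ c').1 u := by
    intro r hr c c' h
    rw [ae_restrict_iff' measurableSet_Icc] at h ⊢
    filter_upwards [h] with u hu hur
    rcases lt_or_ge u t' with hut | hut
    · rw [Control.concat_apply_of_lt _ _ hut, Control.concat_apply_of_lt _ _ hut]
    · rw [Control.concat_apply_of_le _ _ hut, Control.concat_apply_of_le _ _ hut]
      exact hu ⟨hut, hur.2⟩
  -- The continuation of `β` after the fixed past `a₀`; prepending the same past preserves agreement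
  -- a.e., so it is nonanticipative.
  let β' : Strategy A B t' := ⟨fun c => (β.1 (Control.concat a₀ c)).shift ht, by
    intro r hr c c' h
    exact ae_restrict_of_ae_restrict_of_subset (Icc_subset_Icc_left ht)
      (β.2 r (ht.trans hr) _ _ (hcc r hr c c' h))⟩
  have hex := fun c : Control A t' => exists_isStoppedTrajectory hG.isClosed hG.lipschitz
    hG.bounded (Control.concat a₀ c).2 (β.1 (Control.concat a₀ c)).2 s
  choose X hX using hex
  -- A reference continuation fixes the state at `t'` before the minimising `c` is selected;
  -- nonanticipativity of `β` shows below that this state does not depend on `c`.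
  let c₀ : Control A t' := Control.const (Classical.arbitrary A)
  obtain ⟨c, y, hy, hlt⟩ := exists_integral_lt_guaranteedPayoff_add (T := T) (s := X c₀ t')
    hG β' (half_pos hε)
  have hpt : ∀ᵐ u ∂(volume.restrict (Icc t t')),
      (Control.concat a₀ c).1 u = (Control.concat a₀ c₀).1 u :=
    ae_Icc_of_forall_lt fun u hu => by
      rw [Control.concat_apply_of_lt _ _ hu, Control.concat_apply_of_lt _ _ hu]
  have hXt' : X c t' = X c₀ t' :=
    IsStoppedTrajectory.eqOn hG.isClosed hG.lipschitz hG.bounded (Control.concat a₀ c).2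
      (β.1 (Control.concat a₀ c)).2 (Control.concat a₀ c₀).2 (β.1 (Control.concat a₀ c₀)).2
      (hX c) (hX c₀) hpt (β.2 t' ht _ _ hpt) ⟨ht, le_rfl⟩
  have hXr : IsStoppedTrajectory f K t' (X c₀ t') c.1 (β'.1 c).1 (X c) := hXt' ▸
    (hX c).restart hG.isClosed hG.lipschitz hG.bounded (Control.concat a₀ c).2
      (β.1 (Control.concat a₀ c)).2 ht (fun u hu => Control.concat_apply_of_le _ _ hu)
      (fun u _ => rfl)
  have hXy : EqOn (X c) y (Icc t' T) :=
    IsStoppedTrajectory.eqOn hG.isClosed hG.lipschitz hG.bounded c.2 (β'.1 c).2 c.2 (β'.1 c).2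
      hXr hy (ae_of_all _ fun _ => rfl) (ae_of_all _ fun _ => rfl)
  refine ⟨Control.concat a₀ c, β.1 (Control.concat a₀ c), X c,
    fun u hu => Control.concat_apply_of_lt _ _ hu, hX c, ?_⟩
  have h1 := guaranteedPayoff_le (T := T) β (Control.concat a₀ c) (hX c)
  rw [(hX c).integral_outsideCost_split hG ht hT] at h1
  have h2 : ∫ u in t'..T, outsideCost K (X c u) = ∫ u in t'..T, outsideCost K (y u) :=
    intervalIntegral.integral_congr fun u hu => by
      rw [uIcc_of_le hT] at hu
      simp only [hXy hu]
  have h3 := guaranteedPayoff_le_valueFunction (T := T) (s := X c₀ t') hG β'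
  rw [hXt']
  linarith

/-- Player II may start with any feedback `γ` of the control of Player I before time `t'`. -/
theorem exists_integral_add_le_valueFunction (hG : IsRegularGame f K L M) (ht : t ≤ t')
    (hT : t' ≤ T) (s : E) {γ : A → B} (hγ : Measurable γ) {ε : ℝ} (hε : 0 < ε) :
    ∃ (a : Control A t) (b : Control B t) (x : ℝ → E), (∀ u < t', b.1 u = γ (a.1 u)) ∧
      IsStoppedTrajectory f K t s a.1 b.1 x ∧
      (∫ u in t..t', outsideCost K (x u)) + valueFunction f K T (x t') t'
        ≤ valueFunction f K T s t + ε := by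
  -- One nearly optimal strategy per state at time `t'`. The choice need not be measurable in the
  -- state, as strategies carry no measurability in the control.
  choose η hη using fun z : E =>
    exists_valueFunction_lt_guaranteedPayoff_add f K T z t' (half_pos hε)
  have hex := fun a : Control A t => exists_isStoppedTrajectory hG.isClosed hG.lipschitz
    hG.bounded a.2 (a.map γ hγ).2 s
  choose X hX using hex
  -- Play `γ` until `t'`, then the strategy selected for the state reached. That state is determined
  -- by the control up to `t'`, which makes the combination nonanticipative.
  let β : Strategy A B t :=
    ⟨fun a => (a.map γ hγ).concat ((η (X a t')).1 (a.shift ht)), by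
      intro r hr a a' h
      rcases lt_or_ge r t' with hrt | hrt
      · rw [ae_restrict_iff' measurableSet_Icc] at h ⊢
        filter_upwards [h] with u hu hur
        rw [Control.concat_apply_of_lt _ _ (hur.2.trans_lt hrt),
          Control.concat_apply_of_lt _ _ (hur.2.trans_lt hrt)]
        exact congrArg γ (hu hur)
      · have hz : X a t' = X a' t' := by
          have h' := ae_restrict_of_ae_restrict_of_subset
            (Icc_subset_Icc_right hrt) h
          exact IsStoppedTrajectory.eqOn hG.isClosed hG.lipschitz hG.bounded a.2 (a.map γ hγ).2
            a'.2 (a'.map γ hγ).2 (hX a) (hX a') h' (h'.mono fun u hu => congrArg γ hu)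
            ⟨ht, le_rfl⟩
        have h2 := (η (X a t')).2 r hrt (a.shift ht) (a'.shift ht)
          (ae_restrict_of_ae_restrict_of_subset (Icc_subset_Icc_left ht) h)
        simp only [← hz]
        rw [ae_restrict_iff' measurableSet_Icc] at h h2 ⊢
        filter_upwards [h, h2] with u hu hu2 hur
        rcases lt_or_ge u t' with hut | hut
        · rw [Control.concat_apply_of_lt _ _ hut, Control.concat_apply_of_lt _ _ hut]
          exact congrArg γ (hu hur)
        · rw [Control.concat_apply_of_le _ _ hut, Control.concat_apply_of_le _ _ hut]
          exact hu2 ⟨hut, hur.2⟩⟩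
  obtain ⟨a, x, hx, hlt⟩ := exists_integral_lt_guaranteedPayoff_add (T := T) (s := s)
    hG β (half_pos hε)
  have hβγ : ∀ u < t', (β.1 a).1 u = γ (a.1 u) := fun u hu => Control.concat_apply_of_lt _ _ hu
  have hxX : x t' = X a t' :=
    IsStoppedTrajectory.eqOn hG.isClosed hG.lipschitz hG.bounded a.2 (β.1 a).2 a.2
      (a.map γ hγ).2 hx (hX a) (ae_of_all _ fun _ => rfl) (ae_Icc_of_forall_lt hβγ) ⟨ht, le_rfl⟩
  have hxr : IsStoppedTrajectory f K t' (X a t') (a.shift ht).1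
      ((η (X a t')).1 (a.shift ht)).1 x := hxX ▸
    hx.restart hG.isClosed hG.lipschitz hG.bounded a.2 (β.1 a).2 ht (fun u _ => rfl)
      (fun u hu => by
        rw [hxX]
        exact Control.concat_apply_of_le _ _ hu)
  refine ⟨a, β.1 a, x, hβγ, hx, ?_⟩
  have h1 := guaranteedPayoff_le_valueFunction (T := T) (s := s) hG β
  rw [hx.integral_outsideCost_split hG ht hT] at hlt
  have h2 := guaranteedPayoff_le (T := T) _ _ hxr
  have h3 := hη (X a t')
  rw [hxX]
  linarith

end Value

/-! ### Splitting the derivative of a test function into space and time -/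

section TestFunction

variable {E : Type*} [NormedAddCommGroup E] [NormedSpace ℝ E]

theorem fderiv_apply_eq_spaceDeriv_add_timeDeriv {φ : E × ℝ → ℝ} {s : E} {t : ℝ}
    (hφ : DifferentiableAt ℝ φ (s, t)) (v : E) (τ : ℝ) :
    fderiv ℝ φ (s, t) (v, τ) = spaceDeriv φ s t v + τ * timeDeriv φ s t := by
  have h1 : HasFDerivAt (fun x => φ (x, t)) _ s :=
    HasFDerivAt.comp s (hφ.hasFDerivAt : HasFDerivAt φ _ (s, t)) (hasFDerivAt_prodMk_left s t)
  have h2 : HasDerivAt (fun r => φ (s, r)) (fderiv ℝ φ (s, t) (0, 1)) t :=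
    HasFDerivAt.comp_hasDerivAt t (hφ.hasFDerivAt : HasFDerivAt φ _ (s, t))
      ((hasDerivAt_const t s).prodMk (hasDerivAt_id t))
  rw [spaceDeriv, timeDeriv, h1.fderiv, h2.deriv]
  have : (v, τ) = (v, (0 : ℝ)) + τ • ((0 : E), (1 : ℝ)) := by simp
  rw [this, map_add, map_smul]
  simp

end TestFunction

section Value

variable {E A B : Type*} [NormedAddCommGroup E] [NormedSpace ℝ E]
  [MetricSpace A] [SecondCountableTopology A] [MeasurableSpace A] [BorelSpace A] [Nonempty A]
  [MetricSpace B] [SecondCountableTopology B] [MeasurableSpace B] [BorelSpace B] [Nonempty B]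
  [CompleteSpace E] [SecondCountableTopology E]
  {f : E → A → B → E} {K : Set E} {L : NNReal} {M : ℝ} {T t : ℝ} {s : E} {φ : E × ℝ → ℝ}

theorem IsRegularGame.bound_nonneg (hG : IsRegularGame f K L M) : 0 ≤ M :=
  (norm_nonneg _).trans (hG.bounded 0 (Classical.arbitrary A) (Classical.arbitrary B))

/-! ### Short-time expansion of a test function along trajectories -/

theorem intervalIntegrable_hamiltonian_integrand (hG : IsRegularGame f K L M) (c : ℝ)
    (p : E →L[ℝ] ℝ) (a : Control A t) (b : Control B t) {x : ℝ → E}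
    (hx : IsStoppedTrajectory f K t s a.1 b.1 x) {r : ℝ} (hr : t ≤ r) :
    IntervalIntegrable (fun u => c + outsideCost K (x u)
      + p (stoppedField f K (x u) (a.1 u) (b.1 u))) volume t r := by
  refine (intervalIntegrable_const.add
    (intervalIntegrable_outsideCost hG.isClosed hx.continuousOn le_rfl hr)).add ?_
  have := intervalIntegrable_stoppedField hG.isClosed hG.lipschitz hG.bounded a.2 b.2
    hx.continuousOn le_rfl hr
  exact ⟨p.integrable_comp this.1, p.integrable_comp this.2⟩

/-- Strict differentiability at `(s, t)` compares two moving points with a fixed linear map, so a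
single `σ` serves all nearby starting points and all controls. The integral equation turns the
linear increment into an integral with `∂ₜφ` and `∂ₛφ` frozen at `(s, t)`. -/
theorem exists_short_time_expansion (hG : IsRegularGame f K L M) (hφ : ContDiff ℝ 1 φ)
    (ht : t < T) {θ : ℝ} (hθ : 0 < θ) {V : Set E} (hV : V ∈ 𝓝 s) {U : Set (E × ℝ)}
    (hU : U ∈ 𝓝 (s, t)) :
    ∃ σ > 0, ∀ᶠ z in 𝓝 (s, t), z.2 + σ ≤ T ∧
      ∀ (a : Control A z.2) (b : Control B z.2) (x : ℝ → E),
        IsStoppedTrajectory f K z.2 z.1 a.1 b.1 x →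
        (∀ u ∈ Icc z.2 (z.2 + σ), x u ∈ V) ∧ (x (z.2 + σ), z.2 + σ) ∈ U ∧
        |φ (x (z.2 + σ), z.2 + σ) - φ z + (∫ u in z.2..z.2 + σ, outsideCost K (x u))
          - ∫ u in z.2..z.2 + σ, (timeDeriv φ s t + outsideCost K (x u)
            + spaceDeriv φ s t (stoppedField f K (x u) (a.1 u) (b.1 u)))| ≤ θ * σ / 4 := by
  have hM := hG.bound_nonneg
  have hdiff : DifferentiableAt ℝ φ (s, t) := hφ.differentiable one_ne_zero _
  have hstrict : HasStrictFDerivAt φ (fderiv ℝ φ (s, t)) (s, t) :=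
    hφ.contDiffAt.hasStrictFDerivAt one_ne_zero
  -- A trajectory moves at most `(M + 1) * σ` in space-time during time `σ`, so this slope yields
  -- the error `θ * σ / 4`.
  have hε : 0 < θ / (4 * (M + 1)) := by positivity
  have h1 := hstrict.isLittleO.def hε
  rw [nhds_prod_eq] at h1
  obtain ⟨O, hO, hOh⟩ := (eventually_prod_self_iff (r := fun z z' =>
    ‖φ z - φ z' - fderiv ℝ φ (s, t) (z - z')‖ ≤ θ / (4 * (M + 1)) * ‖z - z'‖)).1 h1
  obtain ⟨δ₁, hδ₁, hδO⟩ := Metric.mem_nhds_iff.1 (inter_mem hO hU)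
  obtain ⟨δ₂, hδ₂, hδV⟩ := Metric.mem_nhds_iff.1 hV
  set δ := min (min δ₁ δ₂) (T - t)
  have hδ0 : 0 < δ := lt_min (lt_min hδ₁ hδ₂) (sub_pos.2 ht)
  have hδT : δ ≤ T - t := min_le_right _ _
  have hle1 : δ ≤ δ₁ := (min_le_left _ _).trans (min_le_left _ _)
  have hle2 : δ ≤ δ₂ := (min_le_left _ _).trans (min_le_right _ _)
  -- Half of `δ` is reserved for the starting point, half for the motion.
  set σ := δ / (2 * (M + 1)) with hσ
  have hσ0 : 0 < σ := by positivity
  have hσM : (M + 1) * σ = δ / 2 := by rw [hσ]; field_simp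
  have hσδ : σ ≤ δ / 2 := by nlinarith
  refine ⟨σ, hσ0, ?_⟩
  filter_upwards [Metric.ball_mem_nhds (s, t) (half_pos hδ0)] with z hz
  rw [Metric.mem_ball, Prod.dist_eq, max_lt_iff] at hz
  obtain ⟨hz1, hz2⟩ := hz
  simp only at hz1 hz2
  have hz2' := abs_lt.1 ((Real.dist_eq _ _) ▸ hz2)
  refine ⟨by linarith [hz2'.2], fun a b x hx => ?_⟩
  have hclose : ∀ u ∈ Icc z.2 (z.2 + σ), ‖x u - z.1‖ ≤ M * σ := fun u hu =>
    (hx.norm_sub_le hG.bounded hu.1).trans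
      (mul_le_mul_of_nonneg_left (by linarith [hu.2]) hM)
  have hball : ∀ u ∈ Icc z.2 (z.2 + σ), dist (x u) s < δ := fun u hu => by
    have h1 := hclose u hu
    rw [← dist_eq_norm] at h1
    have := dist_triangle (x u) z.1 s
    linarith
  have hend : z.2 + σ ∈ Icc z.2 (z.2 + σ) := ⟨by linarith, le_rfl⟩
  have hz'mem : (x (z.2 + σ), z.2 + σ) ∈ Metric.ball (s, t) δ₁ := by
    rw [Metric.mem_ball, Prod.dist_eq, max_lt_iff]
    refine ⟨(hball _ hend).trans_le hle1, ?_⟩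
    simp only [Real.dist_eq]
    rw [abs_lt]
    constructor <;> linarith [hz2'.1, hz2'.2]
  have hzmem : z ∈ Metric.ball (s, t) δ₁ := by
    rw [Metric.mem_ball, Prod.dist_eq, max_lt_iff]
    constructor <;> simp only <;> linarith
  refine ⟨fun u hu => hδV ((hball u hu).trans_le hle2), (hδO hz'mem).2, ?_⟩
  have hI := intervalIntegrable_outsideCost hG.isClosed hx.continuousOn le_rfl hend.1
  have hF := intervalIntegrable_stoppedField hG.isClosed hG.lipschitz hG.bounded a.2 b.2
    hx.continuousOn le_rfl hend.1
  have hpF : IntervalIntegrable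
      (fun u => spaceDeriv φ s t (stoppedField f K (x u) (a.1 u) (b.1 u))) volume z.2 (z.2 + σ) :=
    ⟨(spaceDeriv φ s t).integrable_comp hF.1, (spaceDeriv φ s t).integrable_comp hF.2⟩
  have hint : ∫ u in z.2..z.2 + σ, (timeDeriv φ s t + outsideCost K (x u)
      + spaceDeriv φ s t (stoppedField f K (x u) (a.1 u) (b.1 u)))
      = σ * timeDeriv φ s t + (∫ u in z.2..z.2 + σ, outsideCost K (x u))
        + spaceDeriv φ s t (x (z.2 + σ) - z.1) := by
    rw [intervalIntegral.integral_add (intervalIntegrable_const.add hI) hpF,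
      intervalIntegral.integral_add intervalIntegrable_const hI,
      (spaceDeriv φ s t).intervalIntegral_comp_comm hF, hx.integral_eq _ hend.1]
    simp
  have hexp := hOh _ (hδO hz'mem).1 _ (hδO hzmem).1
  have hsub : (x (z.2 + σ), z.2 + σ) - z = (x (z.2 + σ) - z.1, σ) := by
    ext <;> simp
  rw [hsub, fderiv_apply_eq_spaceDeriv_add_timeDeriv hdiff, Real.norm_eq_abs] at hexp
  have hnorm : ‖(x (z.2 + σ) - z.1, σ)‖ ≤ (M + 1) * σ := by
    rw [Prod.norm_def]
    refine max_le ((hclose _ hend).trans (by nlinarith)) ?_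
    simp only [Real.norm_of_nonneg hσ0.le]
    nlinarith
  rw [hint]
  calc _ = |φ (x (z.2 + σ), z.2 + σ) - φ z
        - (spaceDeriv φ s t (x (z.2 + σ) - z.1) + σ * timeDeriv φ s t)| := by
        congr 1; ring
    _ ≤ θ / (4 * (M + 1)) * ((M + 1) * σ) :=
        hexp.trans (mul_le_mul_of_nonneg_left hnorm hε.le)
    _ = θ * σ / 4 := by field_simp

/-- Opening with `a₀` gains `θ * σ`; the expansion and the dynamic programming error each cost `θ *
σ / 4`, leaving `κ = θ * σ / 2`, the same for all nearby `z`. -/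
theorem exists_nearby_improvement_of_control (hG : IsRegularGame f K L M) (hφ : ContDiff ℝ 1 φ)
    (ht : t < T) {θ : ℝ} (hθ : 0 < θ) (a₀ : A)
    (h : ∀ᶠ y in 𝓝 s, ∀ b, timeDeriv φ s t + outsideCost K y
      + spaceDeriv φ s t (stoppedField f K y a₀ b) ≤ -θ) {U : Set (E × ℝ)} (hU : U ∈ 𝓝 (s, t)) :
    ∃ κ > 0, ∀ᶠ z in 𝓝 (s, t), ∃ z' ∈ U,
      valueFunction f K T z.1 z.2 - φ z + κ ≤ valueFunction f K T z'.1 z'.2 - φ z' := by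
  obtain ⟨σ, hσ, hev⟩ := exists_short_time_expansion (f := f) hG hφ ht hθ h hU
  refine ⟨θ * σ / 2, by positivity, ?_⟩
  filter_upwards [hev] with z ⟨hzT, hz⟩
  have hzσ : z.2 ≤ z.2 + σ := by linarith
  obtain ⟨a, b, x, ha, hx, hW⟩ := exists_valueFunction_le_integral_add hG hzσ hzT z.1
    (Control.const a₀) (show 0 < θ * σ / 4 by positivity)
  obtain ⟨hxV, hxU, hexp⟩ := hz a b x hx
  have hmono := intervalIntegral.integral_mono_on_of_le_Ioo hzσ
    (intervalIntegrable_hamiltonian_integrand hG (timeDeriv φ s t) (spaceDeriv φ s t) a b hx hzσ)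
    (intervalIntegrable_const (c := -θ)) fun u hu => by
      rw [ha u hu.2]
      exact hxV u ⟨hu.1.le, hu.2.le⟩ (b.1 u)
  rw [intervalIntegral.integral_const, smul_eq_mul] at hmono
  refine ⟨_, hxU, ?_⟩
  have := (abs_le.1 hexp).2
  simp only
  linarith

/-- The mirror image, with Player II opening by `γ` and the same error budget. -/
theorem exists_nearby_decrease_of_feedback (hG : IsRegularGame f K L M) (hφ : ContDiff ℝ 1 φ)
    (ht : t < T) {θ : ℝ} (hθ : 0 < θ) {γ : A → B} (hγ : Measurable γ)
    (h : ∀ᶠ y in 𝓝 s, ∀ a, θ ≤ timeDeriv φ s t + outsideCost K y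
      + spaceDeriv φ s t (stoppedField f K y a (γ a))) {U : Set (E × ℝ)} (hU : U ∈ 𝓝 (s, t)) :
    ∃ κ > 0, ∀ᶠ z in 𝓝 (s, t), ∃ z' ∈ U,
      valueFunction f K T z'.1 z'.2 - φ z' + κ ≤ valueFunction f K T z.1 z.2 - φ z := by
  obtain ⟨σ, hσ, hev⟩ := exists_short_time_expansion (f := f) hG hφ ht hθ h hU
  refine ⟨θ * σ / 2, by positivity, ?_⟩
  filter_upwards [hev] with z ⟨hzT, hz⟩
  have hzσ : z.2 ≤ z.2 + σ := by linarith
  obtain ⟨a, b, x, hb, hx, hW⟩ := exists_integral_add_le_valueFunction hG hzσ hzT z.1 hγ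
    (show 0 < θ * σ / 4 by positivity)
  obtain ⟨hxV, hxU, hexp⟩ := hz a b x hx
  have hmono := intervalIntegral.integral_mono_on_of_le_Ioo hzσ
    (intervalIntegrable_const (c := θ))
    (intervalIntegrable_hamiltonian_integrand hG (timeDeriv φ s t) (spaceDeriv φ s t) a b hx hzσ)
    fun u hu => by
      rw [hb u hu.2]
      exact hxV u ⟨hu.1.le, hu.2.le⟩ (a.1 u)
  rw [intervalIntegral.integral_const, smul_eq_mul] at hmono
  refine ⟨_, hxU, ?_⟩
  have := (abs_le.1 hexp).1
  simp only
  linarith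

/-! ### The Hamiltonian -/

variable {p : E →L[ℝ] ℝ}

theorem abs_outsideCost_add_le (hG : IsRegularGame f K L M) (y : E) (p : E →L[ℝ] ℝ) (a : A)
    (b : B) : |outsideCost K y + p (stoppedField f K y a b)| ≤ 1 + ‖p‖ * M := by
  refine (abs_add_le _ _).trans (add_le_add ?_ ?_)
  · rw [abs_of_nonneg (outsideCost_nonneg _)]
    exact outsideCost_le_one _
  · exact (p.le_opNorm _).trans
      (mul_le_mul_of_nonneg_left (norm_stoppedField_le hG.bounded _ _ _) (norm_nonneg _))

theorem bddAbove_hamiltonian_integrand (hG : IsRegularGame f K L M) (y : E) (p : E →L[ℝ] ℝ)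
    (a : A) : BddAbove (range fun b => outsideCost K y + p (stoppedField f K y a b)) :=
  ⟨1 + ‖p‖ * M, by
    rintro _ ⟨b, rfl⟩
    exact (abs_le.1 (abs_outsideCost_add_le hG y p a b)).2⟩

theorem neg_le_iSup_hamiltonian_integrand (hG : IsRegularGame f K L M) (y : E) (p : E →L[ℝ] ℝ)
    (a : A) : -(1 + ‖p‖ * M) ≤ ⨆ b, (outsideCost K y + p (stoppedField f K y a b)) :=
  (abs_le.1 (abs_outsideCost_add_le hG y p a (Classical.arbitrary B))).1.trans
    (le_ciSup (bddAbove_hamiltonian_integrand hG y p a) _)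

theorem bddBelow_iSup_hamiltonian_integrand (hG : IsRegularGame f K L M) (y : E)
    (p : E →L[ℝ] ℝ) :
    BddBelow (range fun a => ⨆ b, (outsideCost K y + p (stoppedField f K y a b))) :=
  ⟨-(1 + ‖p‖ * M), by
    rintro _ ⟨a, rfl⟩
    exact neg_le_iSup_hamiltonian_integrand hG y p a⟩

theorem abs_hamiltonian_le (hG : IsRegularGame f K L M) (y : E) (p : E →L[ℝ] ℝ) :
    |hamiltonian f K y p| ≤ 1 + ‖p‖ * M := by
  refine abs_le.2 ⟨le_ciInf fun a => neg_le_iSup_hamiltonian_integrand hG y p a, ?_⟩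
  exact (ciInf_le (bddBelow_iSup_hamiltonian_integrand hG y p) (Classical.arbitrary A)).trans
    (ciSup_le fun b => (abs_le.1 (abs_outsideCost_add_le hG y p _ b)).2)

theorem hamiltonian_eq_zero_of_mem {y : E} (hy : y ∈ K) : hamiltonian f K y p = 0 := by
  simp [hamiltonian, outsideCost_of_mem hy, stoppedField_of_mem hy]

theorem exists_forall_lt_of_hamiltonian_lt (hG : IsRegularGame f K L M) {y : E} {v : ℝ}
    (h : hamiltonian f K y p < v) :
    ∃ a, ∀ b, outsideCost K y + p (stoppedField f K y a b) < v := by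
  obtain ⟨a, ha⟩ := exists_lt_of_ciInf_lt h
  exact ⟨a, fun b => (le_ciSup (bddAbove_hamiltonian_integrand hG y p a) b).trans_lt ha⟩

theorem exists_lt_of_lt_hamiltonian (hG : IsRegularGame f K L M) {y : E} {v : ℝ}
    (h : v < hamiltonian f K y p) (a : A) :
    ∃ b, v < outsideCost K y + p (stoppedField f K y a b) :=
  exists_lt_of_lt_ciSup (h.trans_le (ciInf_le (bddBelow_iSup_hamiltonian_integrand hG y p) a))

theorem abs_apply_sub_apply_le (hG : IsRegularGame f K L M) (p : E →L[ℝ] ℝ) (y y' : E)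
    (a a' : A) (b : B) :
    |p (f y a b) - p (f y' a' b)| ≤ ‖p‖ * L * max (dist y y') (dist a a') := by
  rw [← map_sub, mul_assoc]
  refine (p.le_opNorm _).trans (mul_le_mul_of_nonneg_left ?_ (norm_nonneg _))
  have := hG.lipschitz.dist_le_mul (y, a, b) (y', a', b)
  simpa [Prod.dist_eq, dist_eq_norm] using this

theorem exists_radius (p : E →L[ℝ] ℝ) (L : NNReal) {ε : ℝ} (hε : 0 < ε) :
    ∃ δ > 0, ‖p‖ * L * δ ≤ ε := by
  refine ⟨ε / (‖p‖ * L + 1), by positivity, ?_⟩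
  rw [mul_div_assoc', div_le_iff₀ (by positivity)]
  nlinarith [show 0 ≤ ‖p‖ * L by positivity]

/-- A nearly minimising control at one point `y ∉ K` close to `s` works at all nearby points off
`K`, since `f` is Lipschitz uniformly in `b`; the transfer costs one `θ`. On `K` the expression is
just `c`, covered by `hin`. The point `y` need only occur frequently, so `s` may lie on `∂K`. -/
theorem exists_control_of_hamiltonian_lt (hG : IsRegularGame f K L M) {c θ : ℝ} (hθ : 0 < θ)
    (hin : ∀ᶠ y in 𝓝 s, y ∈ K → c ≤ -θ)
    (hout : (∃ᶠ y in 𝓝 s, y ∉ K) → ∃ᶠ y in 𝓝 s, y ∉ K ∧ hamiltonian f K y p < -c - 2 * θ) :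
    ∃ a, ∀ᶠ y in 𝓝 s, ∀ b, c + outsideCost K y + p (stoppedField f K y a b) ≤ -θ := by
  by_cases hfr : ∃ᶠ y in 𝓝 s, y ∉ K
  · obtain ⟨δ, hδ, hpδ⟩ := exists_radius p L hθ
    have hball := Metric.ball_mem_nhds s (half_pos hδ)
    obtain ⟨y, ⟨hyK, hyH⟩, hys⟩ := ((hout hfr).and_eventually hball).exists
    obtain ⟨a, ha⟩ := exists_forall_lt_of_hamiltonian_lt hG hyH
    refine ⟨a, ?_⟩
    filter_upwards [hin, hball] with z hz hzs b
    by_cases hzK : z ∈ K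
    · rw [outsideCost_of_mem hzK, stoppedField_of_mem hzK, map_zero]
      linarith [hz hzK]
    · have h1 := ha b
      rw [outsideCost_of_notMem hyK, stoppedField_of_notMem hyK] at h1
      rw [outsideCost_of_notMem hzK, stoppedField_of_notMem hzK]
      have hd : max (dist z y) (dist a a) ≤ δ := by
        rw [dist_self, max_eq_left dist_nonneg]
        have := dist_triangle_right z y s
        linarith [Metric.mem_ball.1 hys, Metric.mem_ball.1 hzs]
      have h2 := (abs_le.1 (abs_apply_sub_apply_le hG p z y a a b)).2
      have h3 := mul_le_mul_of_nonneg_left hd (show 0 ≤ ‖p‖ * L by positivity)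
      linarith
  · rw [not_frequently] at hfr
    refine ⟨Classical.arbitrary A, ?_⟩
    filter_upwards [hin, hfr] with z hz hzK b
    rw [outsideCost_of_mem (not_not.1 hzK), stoppedField_of_mem (not_not.1 hzK), map_zero]
    linarith [hz (not_not.1 hzK)]

/-- A measurable, countably valued, almost optimal feedback for Player II. -/
theorem exists_measurable_feedback (hG : IsRegularGame f K L M) {y : E} (hy : y ∉ K) {v ε : ℝ}
    (hε : 0 < ε) (h : v < hamiltonian f K y p) :
    ∃ γ : A → B, Measurable γ ∧ ∀ a, v - ε ≤ 1 + p (f y a (γ a)) := by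
  classical
  obtain ⟨δ, hδ, hpδ⟩ := exists_radius p L hε
  choose g hg using exists_lt_of_lt_hamiltonian hG h
  have hex : ∀ a : A, ∃ i, dist a (TopologicalSpace.denseSeq A i) < δ := fun a =>
    (TopologicalSpace.denseRange_denseSeq A).exists_dist_lt a hδ
  -- Respond to the first member of a dense sequence within `δ` of `a`: the response factors through
  -- a measurable index in `ℕ`, and replacing `a` by that member costs at most `ε`.
  refine ⟨fun a => g (TopologicalSpace.denseSeq A (Nat.find (hex a))), ?_, fun a => ?_⟩
  · exact (measurable_of_countable fun i => g (TopologicalSpace.denseSeq A i)).comp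
      (measurable_find hex fun i => (isOpen_lt (by fun_prop) (by fun_prop)).measurableSet)
  · set a' := TopologicalSpace.denseSeq A (Nat.find (hex a))
    have h1 := hg a'
    rw [outsideCost_of_notMem hy, stoppedField_of_notMem hy] at h1
    have h2 := (abs_le.1 (abs_apply_sub_apply_le hG p y y a a' (g a'))).1
    have hd : max (dist y y) (dist a a') ≤ δ := by
      rw [dist_self, max_eq_right dist_nonneg]
      exact (Nat.find_spec (hex a)).le
    have h3 := mul_le_mul_of_nonneg_left hd (show 0 ≤ ‖p‖ * L by positivity)
    linarith

/-- Of the margin `3 * θ`, one `θ` pays for discretising the feedback and one for moving from `y` to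
other points off `K`. -/
theorem exists_feedback_of_lt_hamiltonian (hG : IsRegularGame f K L M) {c θ : ℝ} (hθ : 0 < θ)
    (hin : ∀ᶠ y in 𝓝 s, y ∈ K → θ ≤ c)
    (hout : (∃ᶠ y in 𝓝 s, y ∉ K) →
      ∃ᶠ y in 𝓝 s, y ∉ K ∧ 3 * θ - c < hamiltonian f K y p) :
    ∃ γ : A → B, Measurable γ ∧
      ∀ᶠ y in 𝓝 s, ∀ a, θ ≤ c + outsideCost K y + p (stoppedField f K y a (γ a)) := by
  by_cases hfr : ∃ᶠ y in 𝓝 s, y ∉ K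
  · obtain ⟨δ, hδ, hpδ⟩ := exists_radius p L hθ
    have hball := Metric.ball_mem_nhds s (half_pos hδ)
    obtain ⟨y, ⟨hyK, hyH⟩, hys⟩ := ((hout hfr).and_eventually hball).exists
    obtain ⟨γ, hγ, hγH⟩ := exists_measurable_feedback hG hyK hθ hyH
    refine ⟨γ, hγ, ?_⟩
    filter_upwards [hin, hball] with z hz hzs a
    by_cases hzK : z ∈ K
    · rw [outsideCost_of_mem hzK, stoppedField_of_mem hzK, map_zero]
      linarith [hz hzK]
    · have h1 := hγH a
      rw [outsideCost_of_notMem hzK, stoppedField_of_notMem hzK]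
      have hd : max (dist z y) (dist a a) ≤ δ := by
        rw [dist_self, max_eq_left dist_nonneg]
        have := dist_triangle_right z y s
        linarith [Metric.mem_ball.1 hys, Metric.mem_ball.1 hzs]
      have h2 := (abs_le.1 (abs_apply_sub_apply_le hG p z y a a (γ a))).1
      have h3 := mul_le_mul_of_nonneg_left hd (show 0 ≤ ‖p‖ * L by positivity)
      linarith
  · rw [not_frequently] at hfr
    refine ⟨fun _ => Classical.arbitrary B, measurable_const, ?_⟩
    filter_upwards [hin, hfr] with z hz hzK a
    rw [outsideCost_of_mem (not_not.1 hzK), stoppedField_of_mem (not_not.1 hzK), map_zero]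
    linarith [hz (not_not.1 hzK)]

end Value

/-! ### Semicontinuous envelopes of locally bounded functions -/

section Envelope

variable {X : Type*} [TopologicalSpace X] {g : X → ℝ} {x : X} {m v : ℝ}

theorem isBoundedUnder_le_of_eventually_abs_le (h : ∀ᶠ y in 𝓝 x, |g y| ≤ m) :
    (𝓝 x).IsBoundedUnder (· ≤ ·) g :=
  isBoundedUnder_of_eventually_le (h.mono fun _ hy => (abs_le.1 hy).2)

theorem isBoundedUnder_ge_of_eventually_abs_le (h : ∀ᶠ y in 𝓝 x, |g y| ≤ m) :
    (𝓝 x).IsBoundedUnder (· ≥ ·) g :=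
  isBoundedUnder_of_eventually_ge (h.mono fun _ hy => (abs_le.1 hy).1)

/-- Every neighbourhood contains `x` itself; the local bound ensures that the real `limsup` is not a
default value. -/
theorem le_upperEnvelope (h : ∀ᶠ y in 𝓝 x, |g y| ≤ m) : g x ≤ upperEnvelope g x :=
  le_limsup_of_frequently_le (fun hev => hev.self_of_nhds le_rfl)
    (isBoundedUnder_le_of_eventually_abs_le h)

theorem lowerEnvelope_le (h : ∀ᶠ y in 𝓝 x, |g y| ≤ m) : lowerEnvelope g x ≤ g x :=
  liminf_le_of_frequently_le (fun hev => hev.self_of_nhds le_rfl)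
    (isBoundedUnder_ge_of_eventually_abs_le h)

theorem upperEnvelope_le (h : ∀ᶠ y in 𝓝 x, |g y| ≤ m) (hv : ∀ᶠ y in 𝓝 x, g y ≤ v) :
    upperEnvelope g x ≤ v :=
  limsup_le_of_le (isBoundedUnder_ge_of_eventually_abs_le h).isCoboundedUnder_le hv

theorem le_lowerEnvelope (h : ∀ᶠ y in 𝓝 x, |g y| ≤ m) (hv : ∀ᶠ y in 𝓝 x, v ≤ g y) :
    v ≤ lowerEnvelope g x :=
  le_liminf_of_le (isBoundedUnder_le_of_eventually_abs_le h).isCoboundedUnder_ge hv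

theorem eventually_lt_of_upperEnvelope_lt (h : ∀ᶠ y in 𝓝 x, |g y| ≤ m)
    (hv : upperEnvelope g x < v) : ∀ᶠ y in 𝓝 x, g y < v :=
  eventually_lt_of_limsup_lt hv (isBoundedUnder_le_of_eventually_abs_le h)

theorem eventually_lt_of_lt_lowerEnvelope (h : ∀ᶠ y in 𝓝 x, |g y| ≤ m)
    (hv : v < lowerEnvelope g x) : ∀ᶠ y in 𝓝 x, v < g y :=
  eventually_lt_of_lt_liminf hv (isBoundedUnder_ge_of_eventually_abs_le h)

end Envelope

/-! ### Verification of the viscosity inequalities and the terminal condition -/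

section Viscosity

variable {E A B : Type*} [NormedAddCommGroup E] [NormedSpace ℝ E]
  [MetricSpace A] [SecondCountableTopology A] [MeasurableSpace A] [BorelSpace A] [Nonempty A]
  [MetricSpace B] [SecondCountableTopology B] [MeasurableSpace B] [BorelSpace B] [Nonempty B]
  [CompleteSpace E] [SecondCountableTopology E]
  {f : E → A → B → E} {K : Set E} {L : NNReal} {M : ℝ} {T t : ℝ} {s : E} {φ : E × ℝ → ℝ}

theorem eventually_abs_valueFunction_le (hG : IsRegularGame f K L M) (ht : t < T) (s : E) :
    ∀ᶠ z in 𝓝 (s, t), |valueFunction f K T z.1 z.2| ≤ T - t + 1 := by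
  have h1 : ∀ᶠ z : E × ℝ in 𝓝 (s, t), z.2 < T := continuous_snd.continuousAt.eventually_lt_const ht
  have h2 : ∀ᶠ z : E × ℝ in 𝓝 (s, t), t - 1 < z.2 :=
    continuous_snd.continuousAt.eventually_const_lt (by simp)
  filter_upwards [h1, h2] with z hz1 hz2
  rw [abs_of_nonneg (valueFunction_nonneg hG hz1.le)]
  linarith [valueFunction_le (s := z.1) hG hz1.le]

theorem eventually_abs_hamiltonian_le (hG : IsRegularGame f K L M) (z : E × (E →L[ℝ] ℝ)) :
    ∀ᶠ y in 𝓝 z, |hamiltonian f K y.1 y.2| ≤ 1 + (‖z.2‖ + 1) * M := by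
  have h1 : ∀ᶠ y : E × (E →L[ℝ] ℝ) in 𝓝 z, ‖y.2‖ < ‖z.2‖ + 1 :=
    (continuous_snd.norm.continuousAt).eventually_lt_const (by simp)
  filter_upwards [h1] with y hy
  have := hG.bound_nonneg
  refine (abs_hamiltonian_le hG y.1 y.2).trans ?_
  gcongr

theorem isEnvelopeViscositySolution_valueFunction (hG : IsRegularGame f K L M) :
    IsEnvelopeViscositySolution (hamiltonian f K) T (valueFunction f K T) where
  locallyBounded s t ht := ⟨_, eventually_abs_valueFunction_le hG ht s⟩
  subsolution φ hφ s t ht hmax := by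
    by_contra! hneg
    set c := timeDeriv φ s t
    set p := spaceDeriv φ s t
    set h := upperEnvelope (fun y : E × (E →L[ℝ] ℝ) => hamiltonian f K y.1 y.2) (s, p)
    obtain ⟨θ, hθ, hθc⟩ : ∃ θ > 0, h < -c - 2 * θ :=
      ⟨-(c + h) / 4, by linarith, by linarith⟩
    -- The envelope bound is needed only on the slice with `p` frozen. At points of `K`, where `H =
    -- 0`, it says `c < -2 * θ`.
    have hH : ∀ᶠ y in 𝓝 s, hamiltonian f K y p < -c - 2 * θ :=
      (Continuous.prodMk_left p).continuousAt.eventually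
        (eventually_lt_of_upperEnvelope_lt (eventually_abs_hamiltonian_le hG (s, p)) hθc)
    obtain ⟨a, ha⟩ := exists_control_of_hamiltonian_lt (p := p) hG hθ
      (hH.mono fun y hy hyK => by
        rw [hamiltonian_eq_zero_of_mem hyK] at hy
        linarith) (fun hfr => hfr.and_eventually hH)
    have hU : ∀ᶠ z in 𝓝 (s, t), z.2 < T ∧
        upperEnvelope (fun y : E × ℝ => valueFunction f K T y.1 y.2) z - φ z
          ≤ upperEnvelope (fun y : E × ℝ => valueFunction f K T y.1 y.2) (s, t) - φ (s, t) :=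
      ((continuous_snd.tendsto' (s, t) t rfl).eventually_lt_const ht).and hmax
    obtain ⟨κ, hκ, hκz⟩ := exists_nearby_improvement_of_control hG hφ ht hθ a ha hU
    have hφκ : ∀ᶠ z in 𝓝 (s, t), φ z < φ (s, t) + κ / 2 :=
      hφ.continuous.continuousAt.eventually_lt_const (by linarith)
    -- For every `z` near `(s, t)`, the improvement at `z'`, then `W ≤ W^*` there, then the local
    -- maximum bound `W z` by `W^*(s, t) - κ / 2`; continuity of `φ` uses up the other half of `κ`.
    -- So the envelope would lie strictly below itself.
    have := upperEnvelope_le (eventually_abs_valueFunction_le (f := f) hG ht s)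
      (v := upperEnvelope (fun y : E × ℝ => valueFunction f K T y.1 y.2) (s, t) - κ / 2) <| by
        filter_upwards [hκz, hφκ] with z ⟨z', ⟨hz'T, hz'⟩, hzz'⟩ hφz
        have := le_upperEnvelope (eventually_abs_valueFunction_le (f := f) hG hz'T z'.1)
        simp only [Prod.mk.eta] at this
        linarith
    linarith
  supersolution φ hφ s t ht hmin := by
    by_contra! hpos
    set c := timeDeriv φ s t
    set p := spaceDeriv φ s t
    set h := lowerEnvelope (fun y : E × (E →L[ℝ] ℝ) => hamiltonian f K y.1 y.2) (s, p)
    obtain ⟨θ, hθ, hθc⟩ : ∃ θ > 0, 3 * θ - c < h :=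
      ⟨(c + h) / 4, by linarith, by linarith⟩
    have hH : ∀ᶠ y in 𝓝 s, 3 * θ - c < hamiltonian f K y p :=
      (Continuous.prodMk_left p).continuousAt.eventually
        (eventually_lt_of_lt_lowerEnvelope (eventually_abs_hamiltonian_le hG (s, p)) hθc)
    obtain ⟨γ, hγ, hγH⟩ := exists_feedback_of_lt_hamiltonian (p := p) hG hθ
      (hH.mono fun y hy hyK => by
        rw [hamiltonian_eq_zero_of_mem hyK] at hy
        linarith) (fun hfr => hfr.and_eventually hH)
    have hU : ∀ᶠ z in 𝓝 (s, t), z.2 < T ∧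
        lowerEnvelope (fun y : E × ℝ => valueFunction f K T y.1 y.2) (s, t) - φ (s, t)
          ≤ lowerEnvelope (fun y : E × ℝ => valueFunction f K T y.1 y.2) z - φ z :=
      ((continuous_snd.tendsto' (s, t) t rfl).eventually_lt_const ht).and hmin
    obtain ⟨κ, hκ, hκz⟩ := exists_nearby_decrease_of_feedback hG hφ ht hθ hγ hγH hU
    have hφκ : ∀ᶠ z in 𝓝 (s, t), φ (s, t) - κ / 2 < φ z :=
      hφ.continuous.continuousAt.eventually_const_lt (by linarith)
    -- Symmetrically, the uniform gap would lift the lower envelope strictly above itself.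
    have := le_lowerEnvelope (eventually_abs_valueFunction_le (f := f) hG ht s)
      (v := lowerEnvelope (fun y : E × ℝ => valueFunction f K T y.1 y.2) (s, t) + κ / 2) <| by
        filter_upwards [hκz, hφκ] with z ⟨z', ⟨hz'T, hz'⟩, hzz'⟩ hφz
        have := lowerEnvelope_le (eventually_abs_valueFunction_le (f := f) hG hz'T z'.1)
        simp only [Prod.mk.eta] at this
        linarith
    linarith

/-- On the line through `s ∈ K` the value vanishes for times before `T`, so `φ (s, ·)` has a local
extremum at `t`. As `H` is zero at `s` too, both pointwise inequalities hold there with equality,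
whatever `∂ₛφ` is. -/
theorem timeDeriv_eq_zero_of_mem (hG : IsRegularGame f K L M) (hs : s ∈ K) (ht : t < T)
    (h : IsLocalMax (fun z => valueFunction f K T z.1 z.2 - φ z) (s, t) ∨
      IsLocalMin (fun z => valueFunction f K T z.1 z.2 - φ z) (s, t)) :
    timeDeriv φ s t = 0 := by
  have hev : ∀ᶠ r in 𝓝 t, r < T := eventually_lt_nhds ht
  have hc : Tendsto (fun r : ℝ => (s, r)) (𝓝 t) (𝓝 (s, t)) :=
    (Continuous.prodMk_right s).continuousAt
  rcases h with h | h
  · refine IsLocalMin.deriv_eq_zero ?_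
    filter_upwards [hc.eventually h, hev] with r hr hrT
    simp only [valueFunction_eq_zero_of_mem hG hs hrT.le,
      valueFunction_eq_zero_of_mem hG hs ht.le] at hr
    linarith
  · refine IsLocalMax.deriv_eq_zero ?_
    filter_upwards [hc.eventually h, hev] with r hr hrT
    simp only [valueFunction_eq_zero_of_mem hG hs hrT.le,
      valueFunction_eq_zero_of_mem hG hs ht.le] at hr
    linarith

theorem isTouchingViscositySolution_valueFunction (hG : IsRegularGame f K L M) :
    IsTouchingViscositySolution (hamiltonian f K) T (valueFunction f K T) where
  subsolution φ hφ s t ht hmax := by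
    by_cases hs : s ∈ K
    · rw [hamiltonian_eq_zero_of_mem hs, timeDeriv_eq_zero_of_mem hG hs ht (Or.inl hmax), add_zero]
    by_contra! hneg
    set c := timeDeriv φ s t
    set p := spaceDeriv φ s t
    obtain ⟨θ, hθ, hθc⟩ : ∃ θ > 0, hamiltonian f K s p < -c - 2 * θ :=
      ⟨-(c + hamiltonian f K s p) / 4, by linarith, by linarith⟩
    -- Off the closed set `K` the condition at points of `K` is vacuous nearby, and `s` itself
    -- serves as the frequent point.
    obtain ⟨a, ha⟩ := exists_control_of_hamiltonian_lt (p := p) hG hθ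
      ((hG.isClosed.isOpen_compl.eventually_mem hs).mono fun y hy hyK => absurd hyK hy)
      (fun _ hev => hev.self_of_nhds ⟨hs, hθc⟩)
    obtain ⟨κ, hκ, hκz⟩ := exists_nearby_improvement_of_control hG hφ ht hθ a ha hmax
    obtain ⟨z', hz', h⟩ := hκz.self_of_nhds
    simp only [mem_ofPred_eq] at hz' h
    linarith
  supersolution φ hφ s t ht hmin := by
    by_cases hs : s ∈ K
    · rw [hamiltonian_eq_zero_of_mem hs, timeDeriv_eq_zero_of_mem hG hs ht (Or.inr hmin), add_zero]
    by_contra! hpos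
    set c := timeDeriv φ s t
    set p := spaceDeriv φ s t
    obtain ⟨θ, hθ, hθc⟩ : ∃ θ > 0, 3 * θ - c < hamiltonian f K s p :=
      ⟨(c + hamiltonian f K s p) / 4, by linarith, by linarith⟩
    obtain ⟨γ, hγ, hγH⟩ := exists_feedback_of_lt_hamiltonian (p := p) hG hθ
      ((hG.isClosed.isOpen_compl.eventually_mem hs).mono fun y hy hyK => absurd hyK hy)
      (fun _ hev => hev.self_of_nhds ⟨hs, hθc⟩)
    obtain ⟨κ, hκ, hκz⟩ := exists_nearby_decrease_of_feedback hG hφ ht hθ hγ hγH hmin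
    obtain ⟨z', hz', h⟩ := hκz.self_of_nhds
    simp only [mem_ofPred_eq] at hz' h
    linarith

/-- The value is squeezed between `0` and `T - t`, uniformly in the state. -/
theorem hasZeroTerminalValue_valueFunction (hG : IsRegularGame f K L M) :
    HasZeroTerminalValue T (valueFunction f K T) := by
  intro s
  have h0 : valueFunction f K T s T = 0 :=
    le_antisymm ((valueFunction_le hG le_rfl).trans_eq (sub_self T)) (valueFunction_nonneg hG le_rfl)
  refine ⟨h0, ?_⟩
  have hlim : Tendsto (fun z : E × ℝ => T - z.2) (𝓝[univ ×ˢ Iic T] (s, T)) (𝓝 0) := by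
    have : Continuous fun z : E × ℝ => T - z.2 := by fun_prop
    simpa using (this.tendsto (s, T)).mono_left nhdsWithin_le_nhds
  rw [ContinuousWithinAt, h0]
  refine squeeze_zero' ?_ ?_ hlim
  · filter_upwards [self_mem_nhdsWithin] with z hz
    exact valueFunction_nonneg hG hz.2
  · filter_upwards [self_mem_nhdsWithin] with z hz
    exact valueFunction_le hG hz.2

end Viscosity
end ReachGame

end

theorem theorem2 {n : ℕ} {A B : Type*}
    [MetricSpace A] [SecondCountableTopology A] [MeasurableSpace A] [BorelSpace A] [Nonempty A]
    [MetricSpace B] [SecondCountableTopology B] [MeasurableSpace B] [BorelSpace B] [Nonempty B]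
    (f : EuclideanSpace ℝ (Fin n) → A → B → EuclideanSpace ℝ (Fin n))
    (hf_lip : ∃ L : NNReal, LipschitzWith L
      (fun z : EuclideanSpace ℝ (Fin n) × A × B => f z.1 z.2.1 z.2.2))
    (hf_bdd : ∃ M : ℝ, ∀ s a b, ‖f s a b‖ ≤ M)
    (K : Set (EuclideanSpace ℝ (Fin n))) (hK : IsClosed K)
    (T : ℝ) (hT : 0 ≤ T) :
    ReachGame.IsEnvelopeViscositySolution (ReachGame.hamiltonian f K) T
        (ReachGame.valueFunction f K T) ∧
      ReachGame.IsTouchingViscositySolution (ReachGame.hamiltonian f K) T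
        (ReachGame.valueFunction f K T) ∧
      ReachGame.HasZeroTerminalValue T (ReachGame.valueFunction f K T) := by
  obtain ⟨L, hL⟩ := hf_lip
  obtain ⟨M, hM⟩ := hf_bdd
  have hG : ReachGame.IsRegularGame f K L M := ⟨hK, hL, hM⟩
  exact ⟨ReachGame.isEnvelopeViscositySolution_valueFunction hG,
    ReachGame.isTouchingViscositySolution_valueFunction hG,
    ReachGame.hasZeroTerminalValue_valueFunction hG⟩
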